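/- Let $(Y,d)$ be a proper metric space with a $\sigma$-finite Borel measure $\mu$ such that $L^2(Y,\mu)$ is an ample $Y$-module, i.e. for every non-zero $f\in C_0(Y)$ the multiplication operator $M_f$ on $L^2(Y,\mu)$ is not compact. Assume that $(Y,d)$ has bounded geometry: there is $\varrho>0$ such that for every $R>0$ there is $N\in\mathbb N$ such that every ball of radius $R$ is covered by $N$ balls of radius $\varrho$. Let $\Gamma$ be a countable discrete group that acts on $Y$ by Lipschitz maps preserving the measure class of $\mu$, with Koopman representation $(\pi_\alpha(\gamma)\xi)(y)=\left(\frac{d\gamma_*\mu}{d\mu}(y)\right)^{1/2}\xi(\gamma^{-1}y)$ on $L^2(Y,\mu)$. Let $\ell\colon\Gamma\to[0,\infty)$ be a proper length function (i.e. $\ell(\gamma)=0$ iff $\gamma=e$, $\ell(\gamma^{-1})=\ell(\gamma)$, $\ell(\gamma\gamma')\le\ell(\gamma)+\ell(\gamma')$, and $\{\ell\le r\}$ is finite for every $r$) and let $\delta_\Gamma$ be the warped metric, i.e. the largest metric on $Y$ with $\delta_\Gamma\le d$ and $\delta_\Gamma(y,\gamma y)\le\ell(\gamma)$ for all $y\in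 Y$, $\gamma\in\Gamma$. For $\rho\in\{d,\delta_\Gamma\}$ let $\mathbb C_{\rm Roe}[Y,\rho]$ be the $*$-algebra of all $T\in B(L^2(Y,\mu))$ that are locally compact ($M_fT$ and $TM_f$ are compact for all $f\in C_c(Y)$) and have finite propagation with respect to $\rho$ (there is $R\ge 0$ with $M_fTM_g=0$ whenever $f,g\in C_0(Y)$ and $\rho(\operatorname{Supp} f,\operatorname{Supp} g)>R$). Put $\|T\|_{\max}=\sup\|\pi(T)\|$, the supremum over all $*$-representations $\pi$ of $\mathbb C_{\rm Roe}[Y,\rho]$ on Hilbert spaces, and let the maximal Roe algebra $C^*_{\max}(Y,\rho)$ be the completion of $\mathbb C_{\rm Roe}[Y,\rho]$ with respect to $\|\cdot\|_{\max}$. Let $\Gamma$ act on $C^*_{\max}(Y,d)$ by the extension of the action $T\mapsto\pi_\alpha(\gamma)T\pi_\alpha(\gamma)^*$ on $\mathbb C_{\rm Roe}[Y,d]$, and let $C^*_{\max}(Y,d)\rtimes_{\max}\Gamma$ be the full crossed product, i.e. the completion of the algebraic crossed product $C^*_{\max}(Y,d)\rtimes_{\rm alg}\Gamma$ with respect to the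 supremum of the norms $\|\pi(\cdot)\|$ over all its $*$-representations $\pi$ on Hilbert spaces. Then $\|\cdot\|_{\max}$ is finite on $\mathbb C_{\rm Roe}[Y,d]$ and on $\mathbb C_{\rm Roe}[Y,\delta_\Gamma]$, and there is a surjective $*$-homomorphism \[ C^*_{\max}(Y,d)\rtimes_{\max}\Gamma\longrightarrow C^*_{\max}(Y,\delta_\Gamma). \] -/

import Mathlib

open MeasureTheory Set Filter Topology
open scoped ENNReal NNReal ZeroAtInfty BoundedContinuousFunction

universe u v

noncomputable section

/-! ## Representations, maximal norms and the associated completions -/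

section MaximalCompletion

/-- A `*`-representation of the `*`-algebra `A` by bounded operators on a complex Hilbert space. -/
structure HilbertRep (A : Type u) [NonUnitalRing A] [StarRing A] [Module ℂ A] where
  H : Type u
  [normed : NormedAddCommGroup H]
  [inner : InnerProductSpace ℂ H]
  [complete : CompleteSpace H]
  π : A →⋆ₙₐ[ℂ] (H →L[ℂ] H)

attribute [instance] HilbertRep.normed HilbertRep.inner HilbertRep.complete

variable (A : Type u) [NonUnitalRing A] [StarRing A] [Module ℂ A]

/-- All the values `‖π x‖`, where `π` runs through the `*`-representations of `A`. -/
def repNorms (x : A) : Set ℝ := Set.range fun R : HilbertRep A => ‖R.π x‖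

/-- The supremum defining the maximal norm is finite on all of `A`. -/
def MaxNormFinite : Prop := ∀ x : A, BddAbove (repNorms A x)

/-- The maximal norm `‖x‖_max = sup {‖π x‖ | π a *-representation of A}`. -/
def maxNorm (x : A) : ℝ := sSup (repNorms A x)

/-- The seminorms `x ↦ ‖π x‖` that come from `*`-representations. -/
def RepSeminorm : Type u := {p : A → ℝ // ∃ R : HilbertRep A, ∀ x, p x = ‖R.π x‖}

variable {A}

/-- A representation inducing the given seminorm. -/
def RepSeminorm.rep (p : RepSeminorm A) : HilbertRep A := Classical.choose p.2

theorem RepSeminorm.norm_rep (p : RepSeminorm A) (x : A) : p.1 x = ‖p.rep.π x‖ :=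
  Classical.choose_spec p.2 x

def HilbertRep.toSeminorm (R : HilbertRep A) : RepSeminorm A :=
  ⟨fun x => ‖R.π x‖, R, fun _ => rfl⟩

theorem HilbertRep.norm_toSeminorm_rep (R : HilbertRep A) (x : A) :
    ‖R.toSeminorm.rep.π x‖ = ‖R.π x‖ :=
  (R.toSeminorm.norm_rep x).symm

/-- The bounded families of operators, one operator for each representation seminorm. -/
def RepProduct (A : Type u) [NonUnitalRing A] [StarRing A] [Module ℂ A] : Type u :=
  lp (fun p : RepSeminorm A => p.rep.H →L[ℂ] p.rep.H) ∞

instance : NonUnitalCStarAlgebra (RepProduct A) :=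
  inferInstanceAs (NonUnitalCStarAlgebra (lp (fun p : RepSeminorm A => p.rep.H →L[ℂ] p.rep.H) ∞))

theorem norm_rep_le (h : MaxNormFinite A) (R : HilbertRep A) (x : A) : ‖R.π x‖ ≤ maxNorm A x :=
  le_csSup (h x) ⟨R, rfl⟩

/-- The direct sum of all representations. -/
def toRepProduct (h : MaxNormFinite A) : A →⋆ₙₐ[ℂ] RepProduct A where
  toFun x := ⟨fun p => p.rep.π x, memℓp_infty ⟨maxNorm A x, by
    rintro _ ⟨p, rfl⟩
    exact norm_rep_le h p.rep x⟩⟩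
  map_smul' c x := Subtype.ext (funext fun p => map_smul p.rep.π c x)
  map_zero' := Subtype.ext (funext fun p => map_zero p.rep.π)
  map_add' x y := Subtype.ext (funext fun p => map_add p.rep.π x y)
  map_mul' x y := Subtype.ext (funext fun p => map_mul p.rep.π x y)
  map_star' x := Subtype.ext (funext fun p => map_star p.rep.π x)

instance : Nonempty (HilbertRep A) := ⟨{ H := PUnit, π := 0 }⟩

theorem norm_toRepProduct (h : MaxNormFinite A) (x : A) : ‖toRepProduct h x‖ = maxNorm A x := by
  have hne : (repNorms A x).Nonempty := Set.range_nonempty _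
  apply le_antisymm
  · refine lp.norm_le_of_forall_le (E := fun p : RepSeminorm A => p.rep.H →L[ℂ] p.rep.H)
      ?_ ?_
    · obtain ⟨_, R, rfl⟩ := hne
      exact (norm_nonneg _).trans (norm_rep_le h R x)
    · intro p
      exact norm_rep_le h p.rep x
  · apply csSup_le hne
    rintro _ ⟨R, rfl⟩
    exact (R.norm_toSeminorm_rep x).symm.le.trans
      (lp.norm_apply_le_norm (E := fun p : RepSeminorm A => p.rep.H →L[ℂ] p.rep.H) (p := ∞)
        (by simp) (toRepProduct h x) R.toSeminorm)

/-- The Hausdorff completion of the `*`-algebra `A` with respect to its maximal norm, realised as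
the closure of the image of `A` under the direct sum of its representations: the map
`MaxCStar.of : A → MaxCStar h` has dense range (`MaxCStar.denseRange_of`), it satisfies
`‖of x‖ = ‖x‖_max` (`MaxCStar.norm_of`), and `MaxCStar h` is complete. -/
def MaxCStar (h : MaxNormFinite A) : Type u :=
  (NonUnitalStarAlgHom.range (toRepProduct h)).topologicalClosure

namespace MaxCStar

instance (h : MaxNormFinite A) : NonUnitalCStarAlgebra (MaxCStar h) :=
  NonUnitalStarSubalgebra.nonUnitalCStarAlgebra
    (NonUnitalStarAlgHom.range (toRepProduct h)).topologicalClosure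
    (h_closed := NonUnitalStarSubalgebra.isClosed_topologicalClosure _)

/-- The canonical map into the completion. -/
def of (h : MaxNormFinite A) : A →⋆ₙₐ[ℂ] MaxCStar h where
  toFun x := ⟨toRepProduct h x, NonUnitalStarSubalgebra.le_topologicalClosure _
    (NonUnitalStarAlgHom.mem_range_self _ x)⟩
  map_smul' c x := Subtype.ext (map_smul (toRepProduct h) c x)
  map_zero' := Subtype.ext (map_zero (toRepProduct h))
  map_add' x y := Subtype.ext (map_add (toRepProduct h) x y)
  map_mul' x y := Subtype.ext (map_mul (toRepProduct h) x y)
  map_star' x := Subtype.ext (map_star (toRepProduct h) x)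

theorem norm_of (h : MaxNormFinite A) (x : A) : ‖of h x‖ = maxNorm A x :=
  norm_toRepProduct h x

theorem denseRange_of (h : MaxNormFinite A) : DenseRange (of h) := by
  intro y
  rw [mem_closure_iff_seq_limit]
  have hy : (y.1 : RepProduct A) ∈ closure (Set.range (toRepProduct h)) := by
    have := y.2
    rw [← NonUnitalStarAlgHom.coe_range]
    exact this
  obtain ⟨s, hs, hl⟩ := mem_closure_iff_seq_limit.1 hy
  choose a ha using hs
  refine ⟨fun n => of h (a n), fun n => ⟨a n, rfl⟩, ?_⟩
  rw [tendsto_iff_norm_sub_tendsto_zero] at hl ⊢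
  refine hl.congr fun n => ?_
  rw [← ha n]
  rfl

variable {B : Type*} [NonUnitalCStarAlgebra B]

/-- A `*`-homomorphism into a C⋆-algebra that is contractive for the maximal norm extends uniquely
to the completion. -/
def lift (h : MaxNormFinite A) (φ : A →⋆ₙₐ[ℂ] B) (hφ : ∀ x, ‖φ x‖ ≤ maxNorm A x) :
    MaxCStar h →⋆ₙₐ[ℂ] B :=
  let e : A →ₗ[ℂ] MaxCStar h := (of h : A →ₗ[ℂ] MaxCStar h)
  let f : A →ₗ[ℂ] B := (φ : A →ₗ[ℂ] B)
  have hd : DenseRange e := denseRange_of h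
  have hn : ∃ C, ∀ x, ‖f x‖ ≤ C * ‖e x‖ := ⟨1, fun x => by
    rw [one_mul]; exact (hφ x).trans (norm_of h x).ge⟩
  have key : ∀ x, f.extendOfNorm e (of h x) = φ x := fun x => LinearMap.extendOfNorm_eq hd hn x
  { toFun := f.extendOfNorm e
    map_smul' := fun c x => map_smul _ c x
    map_zero' := map_zero _
    map_add' := fun x y => map_add _ x y
    map_mul' := fun x y => by
      refine (denseRange_of h).induction_on₂
        (p := fun x y => f.extendOfNorm e (x * y) = f.extendOfNorm e x * f.extendOfNorm e y)
        ?_ ?_ x y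
      · exact isClosed_eq (by fun_prop) (by fun_prop)
      · intro a b
        rw [← map_mul, key, key, key, map_mul]
    map_star' := fun x => by
      refine (denseRange_of h).induction_on
        (p := fun x => f.extendOfNorm e (star x) = star (f.extendOfNorm e x)) x ?_ ?_
      · exact isClosed_eq (by fun_prop) (by fun_prop)
      · intro a
        rw [← map_star, key, key, map_star] }

theorem lift_of (h : MaxNormFinite A) (φ : A →⋆ₙₐ[ℂ] B) (hφ : ∀ x, ‖φ x‖ ≤ maxNorm A x) (x : A) :
    lift h φ hφ (of h x) = φ x :=
  LinearMap.extendOfNorm_eq (f := (φ : A →ₗ[ℂ] B)) (e := (of h : A →ₗ[ℂ] MaxCStar h))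
    (denseRange_of h) ⟨1, fun x => by rw [one_mul]; exact (hφ x).trans (norm_of h x).ge⟩ x

theorem hom_ext {h : MaxNormFinite A} {φ ψ : MaxCStar h →⋆ₙₐ[ℂ] B}
    (H : ∀ x, φ (of h x) = ψ (of h x)) : φ = ψ := by
  ext x
  refine (denseRange_of h).induction_on (p := fun x => φ x = ψ x) x ?_ H
  exact isClosed_eq (AddMonoidHomClass.continuous_of_bound φ 1 fun x => by
      rw [one_mul]; exact NonUnitalStarAlgHom.norm_apply_le φ x)
    (AddMonoidHomClass.continuous_of_bound ψ 1 fun x => by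
      rw [one_mul]; exact NonUnitalStarAlgHom.norm_apply_le ψ x)

/-- Restricting representations along a `*`-homomorphism shows that it is contractive for the
maximal norms. -/
theorem maxNorm_map_le {A' : Type u} [NonUnitalRing A'] [StarRing A'] [Module ℂ A']
    (φ : A' →⋆ₙₐ[ℂ] A) (h' : MaxNormFinite A') (x : A') :
    maxNorm A (φ x) ≤ maxNorm A' x := by
  apply csSup_le (Set.range_nonempty _)
  rintro _ ⟨R, rfl⟩
  exact norm_rep_le h' { H := R.H, π := R.π.comp φ } x

/-- The extension to the maximal completions of a `*`-homomorphism. -/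
def map {A' : Type u} [NonUnitalRing A'] [StarRing A'] [Module ℂ A']
    (h' : MaxNormFinite A') (h : MaxNormFinite A) (φ : A' →⋆ₙₐ[ℂ] A) :
    MaxCStar h' →⋆ₙₐ[ℂ] MaxCStar h :=
  lift h' ((of h).comp φ) fun x => (norm_of h (φ x)).le.trans (maxNorm_map_le φ h' x)

theorem map_of {A' : Type u} [NonUnitalRing A'] [StarRing A'] [Module ℂ A']
    (h' : MaxNormFinite A') (h : MaxNormFinite A) (φ : A' →⋆ₙₐ[ℂ] A) (x : A') :
    map h' h φ (of h' x) = of h (φ x) :=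
  lift_of _ _ _ _

/-- The extension to the maximal completion of an action by `*`-homomorphisms. -/
def mapAction {Γ : Type v} [Group Γ] (h : MaxNormFinite A) (α : Γ →* (A →⋆ₙₐ[ℂ] A)) :
    Γ →* (MaxCStar h →⋆ₙₐ[ℂ] MaxCStar h) where
  toFun γ := map h h (α γ)
  map_one' := hom_ext fun x => by rw [map_of, map_one]; rfl
  map_mul' γ γ' := hom_ext fun x => by
    rw [map_of, map_mul]
    exact ((congrArg (map h h (α γ)) (map_of h h (α γ') x)).trans (map_of h h (α γ) _)).symm

end MaxCStar

end MaximalCompletion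

/-! ## Crossed products -/

section CrossedProduct

variable {B : Type u} {Γ : Type v} [NonUnitalRing B] [StarRing B] [Module ℂ B]
  [Group Γ]

/-- The algebraic crossed product `B ⋊_alg Γ`: finite formal sums `∑ (b_γ, γ)`, with
`(b, γ) (b', γ') = (b α_γ(b'), γ γ')` and `(b, γ)* = (α_{γ⁻¹}(b*), γ⁻¹)`. -/
def AlgCrossedProduct (_α : Γ →* (B →⋆ₙₐ[ℂ] B)) : Type (max u v) := Γ →₀ B

namespace AlgCrossedProduct

variable {α : Γ →* (B →⋆ₙₐ[ℂ] B)}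

instance : AddCommGroup (AlgCrossedProduct α) := inferInstanceAs (AddCommGroup (Γ →₀ B))

instance : Module ℂ (AlgCrossedProduct α) := inferInstanceAs (Module ℂ (Γ →₀ B))

/-- The formal summand `(b, γ)`. -/
def single (γ : Γ) : B →+ AlgCrossedProduct α := Finsupp.singleAddHom γ

theorem smul_single (c : ℂ) (γ : Γ) (b : B) :
    c • (single γ b : AlgCrossedProduct α) = single γ (c • b) :=
  Finsupp.smul_single c γ b

theorem addHom_ext {M : Type*} [AddCommMonoid M] {f g : AlgCrossedProduct α →+ M}
    (H : ∀ γ b, f (single γ b) = g (single γ b)) : f = g :=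
  Finsupp.addHom_ext H

/-- The additive map out of the crossed product with prescribed values on the summands. -/
def liftAdd {M : Type*} [AddCommMonoid M] (f : Γ → B →+ M) : AlgCrossedProduct α →+ M :=
  Finsupp.liftAddHom f

@[simp]
theorem liftAdd_single {M : Type*} [AddCommMonoid M] (f : Γ → B →+ M) (γ : Γ) (b : B) :
    liftAdd f (single γ b : AlgCrossedProduct α) = f γ b :=
  Finsupp.liftAddHom_apply_single f γ b

/-- The multiplication, as a biadditive map. -/
def mulHom : AlgCrossedProduct α →+ AlgCrossedProduct α →+ AlgCrossedProduct α :=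
  liftAdd fun γ => AddMonoidHom.flip <| liftAdd fun γ' => AddMonoidHom.flip <|
    { toFun := fun b => (single (γ * γ')).comp ((AddMonoidHom.mulLeft b).comp
        (α γ : B →+ B))
      map_zero' := by ext; simp
      map_add' := fun x y => by ext1 z; simp [add_mul] }

instance : Mul (AlgCrossedProduct α) := ⟨fun x y => mulHom x y⟩

theorem mul_def (x y : AlgCrossedProduct α) : x * y = mulHom x y := rfl

@[simp]
theorem single_mul_single (γ γ' : Γ) (b b' : B) :
    (single γ b * single γ' b' : AlgCrossedProduct α) = single (γ * γ') (b * α γ b') := by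
  simp [mul_def, mulHom]

/-- The involution, as an additive map. -/
def starHom : AlgCrossedProduct α →+ AlgCrossedProduct α :=
  liftAdd fun γ => (single γ⁻¹).comp ((α γ⁻¹ : B →+ B).comp (starAddEquiv : B ≃+ B).toAddMonoidHom)

instance : Star (AlgCrossedProduct α) := ⟨fun x => starHom x⟩

theorem star_def (x : AlgCrossedProduct α) : star x = starHom x := rfl

@[simp]
theorem star_single (γ : Γ) (b : B) :
    star (single γ b : AlgCrossedProduct α) = single γ⁻¹ (α γ⁻¹ (star b)) := by
  simp [star_def, starHom]

theorem act_mul (γ γ' : Γ) (b : B) : α (γ * γ') b = α γ (α γ' b) := by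
  rw [map_mul]; rfl

theorem act_one (b : B) : α 1 b = b := by
  rw [map_one]; rfl

theorem induction_on {p : AlgCrossedProduct α → Prop} (x : AlgCrossedProduct α) (h0 : p 0)
    (hadd : ∀ x y, p x → p y → p (x + y)) (hs : ∀ γ b, p (single γ b)) : p x :=
  Finsupp.induction_linear (motive := p) x h0 hadd hs

instance : NonUnitalRing (AlgCrossedProduct α) :=
  { (inferInstance : AddCommGroup (AlgCrossedProduct α)) with
    mul := (· * ·)
    left_distrib := fun x y z => by simp only [mul_def, map_add]
    right_distrib := fun x y z => by simp only [mul_def, map_add, AddMonoidHom.add_apply]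
    zero_mul := fun x => by simp only [mul_def, map_zero, AddMonoidHom.zero_apply]
    mul_zero := fun x => by simp only [mul_def, map_zero]
    mul_assoc := fun x y z => by
      induction x using induction_on with
      | h0 => simp only [mul_def, map_zero, AddMonoidHom.zero_apply]
      | hadd a b ha hb => simp only [mul_def, map_add, AddMonoidHom.add_apply] at *; rw [ha, hb]
      | hs γ₁ b₁ =>
      induction y using induction_on with
      | h0 => simp only [mul_def, map_zero, AddMonoidHom.zero_apply]
      | hadd a b ha hb => simp only [mul_def, map_add, AddMonoidHom.add_apply] at *; rw [ha, hb]
      | hs γ₂ b₂ =>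
      induction z using induction_on with
      | h0 => simp only [mul_def, map_zero]
      | hadd a b ha hb => simp only [mul_def, map_add] at *; rw [ha, hb]
      | hs γ₃ b₃ => simp only [single_mul_single, map_mul (α γ₁), act_mul, mul_assoc] }

instance : StarRing (AlgCrossedProduct α) where
  star_involutive x := by
    induction x using induction_on with
    | h0 => simp only [star_def, map_zero]
    | hadd a b ha hb => simp only [star_def, map_add] at *; rw [ha, hb]
    | hs γ b => rw [star_single, star_single, ← map_star, star_star, ← act_mul, inv_inv,
        mul_inv_cancel, act_one]
  star_add x y := by simp only [star_def, map_add]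
  star_mul x y := by
    induction x using induction_on with
    | h0 => simp only [star_def, map_zero, zero_mul, mul_zero]
    | hadd a b ha hb => simp only [star_def, map_add, add_mul, mul_add] at *; rw [ha, hb]
    | hs γ₁ b₁ =>
    induction y using induction_on with
    | h0 => simp only [star_def, map_zero, zero_mul, mul_zero]
    | hadd a b ha hb => simp only [star_def, map_add, add_mul, mul_add] at *; rw [ha, hb]
    | hs γ₂ b₂ =>
      rw [single_mul_single, star_single, star_single, star_single, single_mul_single, star_mul,
        mul_inv_rev, ← map_star, map_mul, ← act_mul, ← act_mul, mul_assoc, inv_mul_cancel, mul_one]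

end AlgCrossedProduct

end CrossedProduct

section FullCrossedProduct

variable {B : Type u} {Γ : Type v} [NonUnitalCStarAlgebra B] [Group Γ]

open AlgCrossedProduct

/-- For a C⋆-algebra `B`, every `*`-representation `π` of `B ⋊_alg Γ` satisfies
`‖π (∑ (b_γ, γ))‖ ≤ ∑ ‖b_γ‖`, so the norm of the full crossed product is finite. -/
theorem AlgCrossedProduct.maxNormFinite (α : Γ →* (B →⋆ₙₐ[ℂ] B)) :
    MaxNormFinite (AlgCrossedProduct α) := by
  intro x
  induction x using AlgCrossedProduct.induction_on with
  | h0 =>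
    refine ⟨0, ?_⟩
    rintro _ ⟨R, rfl⟩
    simp
  | hadd a b ha hb =>
    obtain ⟨Ca, hCa⟩ := ha
    obtain ⟨Cb, hCb⟩ := hb
    refine ⟨Ca + Cb, ?_⟩
    rintro _ ⟨R, rfl⟩
    simp only [map_add]
    exact (norm_add_le _ _).trans (add_le_add (hCa ⟨R, rfl⟩) (hCb ⟨R, rfl⟩))
  | hs γ b =>
    refine ⟨‖b‖, ?_⟩
    rintro _ ⟨R, rfl⟩
    let φ : B →⋆ₙₐ[ℂ] (R.H →L[ℂ] R.H) :=
      { toFun := fun b => R.π (single 1 b)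
        map_smul' := fun c b => by rw [← smul_single, map_smul]; rfl
        map_zero' := by simp
        map_add' := fun x y => by simp
        map_mul' := fun x y => by
          rw [← map_mul, single_mul_single, one_mul, act_one]
        map_star' := fun x => by
          rw [← map_star, star_single, inv_one, act_one] }
    have h1 : star (R.π (single γ b)) * R.π (single γ b) = φ (α γ⁻¹ (star b * b)) := by
      rw [← map_star, ← map_mul, star_single, single_mul_single, inv_mul_cancel, ← map_mul]
      rfl
    have h2 : ‖R.π (single γ b)‖ * ‖R.π (single γ b)‖ ≤ ‖b‖ * ‖b‖ := by
      rw [← CStarRing.norm_star_mul_self, h1, ← CStarRing.norm_star_mul_self]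
      exact (NonUnitalStarAlgHom.norm_apply_le φ _).trans
        (NonUnitalStarAlgHom.norm_apply_le (α γ⁻¹) _)
    exact (mul_self_le_mul_self_iff (norm_nonneg _) (norm_nonneg _)).2 h2

/-- The full crossed product `B ⋊_max Γ` of a C⋆-algebra `B` by a discrete group `Γ`: the completion
of `B ⋊_alg Γ` with respect to `‖x‖ = sup {‖π x‖ | π a *-representation of B ⋊_alg Γ}`. -/
abbrev FullCrossedProduct (α : Γ →* (B →⋆ₙₐ[ℂ] B)) : Type (max u v) :=
  MaxCStar (AlgCrossedProduct.maxNormFinite α)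

end FullCrossedProduct

/-! ## Roe algebras of metric measure spaces -/

section CompactAdjoint

variable {H : Type*} [NormedAddCommGroup H] [InnerProductSpace ℂ H] [CompleteSpace H]

/-- The adjoint of a compact operator on a Hilbert space is compact. -/
theorem isCompactOperator_star {T : H →L[ℂ] H} (hT : IsCompactOperator T) :
    IsCompactOperator (star T : H →L[ℂ] H) := by
  have hTT : IsCompactOperator (T * star T : H →L[ℂ] H) := hT.comp_clm (star T)
  refine (isCompactOperator_iff_isCompact_closure_image_ball (σ₁₂ := RingHom.id ℂ)
    (star T : H →L[ℂ] H).toLinearMap one_pos).2 ?_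
  have hc := (isCompactOperator_iff_isCompact_closure_image_ball (σ₁₂ := RingHom.id ℂ)
    (T * star T : H →L[ℂ] H).toLinearMap one_pos).1 hTT
  have htb : TotallyBounded ((T * star T : H →L[ℂ] H) '' Metric.ball 0 1) :=
    hc.totallyBounded.subset subset_closure
  refine (TotallyBounded.closure ?_).isCompact_of_isClosed isClosed_closure
  rw [Metric.totallyBounded_iff]
  intro ε hε
  obtain ⟨t, hts, htf, htc⟩ := totallyBounded_iff_subset.1 htb
    {p | dist p.1 p.2 < ε ^ 2 / 2} (Metric.dist_mem_uniformity (by positivity))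
  have hts' : ∀ z ∈ t, ∃ x ∈ Metric.ball (0 : H) 1, (T * star T : H →L[ℂ] H) x = z := hts
  choose! y hy using hts'
  refine ⟨(fun z => (star T : H →L[ℂ] H) (y z)) '' t, htf.image _, ?_⟩
  rintro _ ⟨x, hx, rfl⟩
  obtain ⟨z, hz, hxz⟩ := mem_iUnion₂.1 (htc ⟨x, hx, rfl⟩)
  refine mem_iUnion₂.2 ⟨_, ⟨z, hz, rfl⟩, ?_⟩
  have hyz := hy z hz
  have hxz' : ‖(T * star T : H →L[ℂ] H) (x - y z)‖ < ε ^ 2 / 2 := by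
    rw [map_sub, hyz.2, ← dist_eq_norm]
    exact hxz
  have hn : ‖x - y z‖ ≤ 2 := by
    have h1 : ‖x‖ < 1 := by simpa using hx
    have h2 : ‖y z‖ < 1 := by simpa using hyz.1
    linarith [norm_sub_le x (y z)]
  have hsq : ‖(star T : H →L[ℂ] H) (x - y z)‖ ^ 2 ≤
      ‖(T * star T : H →L[ℂ] H) (x - y z)‖ * ‖x - y z‖ := by
    have h1 : inner ℂ ((T * star T : H →L[ℂ] H) (x - y z)) (x - y z) =
        inner ℂ ((star T : H →L[ℂ] H) (x - y z)) ((star T : H →L[ℂ] H) (x - y z)) := by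
      rw [ContinuousLinearMap.star_eq_adjoint, ContinuousLinearMap.adjoint_inner_right]
      rfl
    rw [← inner_self_eq_norm_sq (𝕜 := ℂ), ← h1]
    exact (RCLike.re_le_norm _).trans (norm_inner_le_norm _ _)
  have : ‖(star T : H →L[ℂ] H) (x - y z)‖ ^ 2 < ε ^ 2 := by
    nlinarith [norm_nonneg ((T * star T : H →L[ℂ] H) (x - y z)), norm_nonneg (x - y z)]
  rw [mem_ball_iff_norm]
  have h3 := lt_of_pow_lt_pow_left₀ 2 hε.le this
  rwa [map_sub] at h3

end CompactAdjoint

section Roe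

/-- The Hilbert space `L²(Z, μ)` of complex-valued functions. -/
abbrev L2 {Z : Type u} [MeasurableSpace Z] (μ : Measure Z) : Type u := Lp ℂ 2 μ

section MulOp

variable {Z : Type u} [TopologicalSpace Z] [MeasurableSpace Z] [BorelSpace Z] (μ : Measure Z)

theorem memLp_top_bcf (f : Z →ᵇ ℂ) : MemLp f ∞ μ :=
  memLp_top_of_bound f.continuous.aestronglyMeasurable ‖f‖ (.of_forall f.norm_coe_le_norm)

/-- The multiplication operator `M_f` on `L²(Z, μ)`. -/
def mulOp (f : Z →ᵇ ℂ) : L2 μ →L[ℂ] L2 μ :=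
  (ContinuousLinearMap.mul ℂ ℂ).holderL μ ∞ 2 2 (memLp_top_bcf μ f).toLp

theorem mulOp_coe (f : Z →ᵇ ℂ) (ξ : L2 μ) : mulOp μ f ξ =ᵐ[μ] fun z => f z * ξ z := by
  have h1 := (ContinuousLinearMap.mul ℂ ℂ).coeFn_holder (r := 2) (memLp_top_bcf μ f).toLp ξ
  have h2 := (memLp_top_bcf μ f).coeFn_toLp
  filter_upwards [h1, h2] with z hz1 hz2
  rw [← hz2]
  exact hz1

theorem mulOp_add (f g : Z →ᵇ ℂ) : mulOp μ (f + g) = mulOp μ f + mulOp μ g := by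
  ext1 ξ
  apply Lp.ext
  rw [add_apply]
  filter_upwards [mulOp_coe μ (f + g) ξ, mulOp_coe μ f ξ, mulOp_coe μ g ξ,
    Lp.coeFn_add (mulOp μ f ξ) (mulOp μ g ξ)] with z h1 h2 h3 h4
  rw [h1, h4, Pi.add_apply, h2, h3, BoundedContinuousFunction.add_apply, add_mul]

theorem mulOp_mul (f g : Z →ᵇ ℂ) : mulOp μ (f * g) = mulOp μ f * mulOp μ g := by
  ext1 ξ
  apply Lp.ext
  rw [mul_apply_eq_comp]
  filter_upwards [mulOp_coe μ (f * g) ξ, mulOp_coe μ f (mulOp μ g ξ), mulOp_coe μ g ξ]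
    with z h1 h2 h3
  rw [h1, h2, h3, BoundedContinuousFunction.mul_apply, mul_assoc]

theorem mulOp_one : mulOp μ (1 : Z →ᵇ ℂ) = 1 := by
  ext1 ξ
  apply Lp.ext
  filter_upwards [mulOp_coe μ 1 ξ] with z h1
  rw [h1]
  simp

theorem star_mulOp (f : Z →ᵇ ℂ) : star (mulOp μ f) = mulOp μ (star f) := by
  rw [ContinuousLinearMap.star_eq_adjoint]
  symm
  rw [ContinuousLinearMap.eq_adjoint_iff]
  intro ξ η
  rw [L2.inner_def, L2.inner_def]
  apply integral_congr_ae
  filter_upwards [mulOp_coe μ (star f) ξ, mulOp_coe μ f η] with z h1 h2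
  rw [h1, h2]
  simp
  ring

/-- `L²(Z, μ)` is an ample module: no non-zero function in `C₀(Z)` acts as a compact operator. -/
def IsAmpleL2 : Prop :=
  ∀ f : C₀(Z, ℂ), f ≠ 0 → ¬ IsCompactOperator (mulOp μ f.toBCF)

/-- `T` is locally compact: `M_f T` and `T M_f` are compact for all `f ∈ C_c(Z)`. -/
def IsLocallyCompactOp (T : L2 μ →L[ℂ] L2 μ) : Prop :=
  ∀ f : C₀(Z, ℂ), HasCompactSupport f →
    IsCompactOperator (mulOp μ f.toBCF * T) ∧ IsCompactOperator (T * mulOp μ f.toBCF)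

end MulOp

/-- The distance `inf {d(a, b) | a ∈ A, b ∈ B}` between two subsets, with values in `[0, ∞]`. -/
def setEDist {Z : Type*} [MetricSpace Z] (A B : Set Z) : ℝ≥0∞ :=
  ⨅ a ∈ A, ⨅ b ∈ B, edist a b

/-- `T` has finite propagation: there is `R ≥ 0` such that `M_f T M_g = 0` for all `f, g ∈ C₀(Z)`
with `d(Supp f, Supp g) > R`. -/
def HasFinitePropagation {Z : Type u} [MetricSpace Z] [MeasurableSpace Z] [BorelSpace Z]
    (μ : Measure Z) (T : L2 μ →L[ℂ] L2 μ) : Prop :=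
  ∃ R : ℝ≥0, ∀ f g : C₀(Z, ℂ), (R : ℝ≥0∞) < setEDist (tsupport f) (tsupport g) →
    mulOp μ f.toBCF * T * mulOp μ g.toBCF = 0

section SetEDist

variable {Z : Type*} [MetricSpace Z]

theorem setEDist_mono {A A' B B' : Set Z} (hA : A ⊆ A') (hB : B ⊆ B') :
    setEDist A' B' ≤ setEDist A B :=
  le_iInf₂ fun a ha => le_iInf₂ fun b hb =>
    (iInf₂_le a (hA ha)).trans (iInf₂_le b (hB hb))

theorem setEDist_comm (A B : Set Z) : setEDist A B = setEDist B A := by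
  apply le_antisymm <;>
  exact le_iInf₂ fun a ha => le_iInf₂ fun b hb =>
    ((iInf₂_le b hb).trans (iInf₂_le a ha)).trans_eq (edist_comm b a)

theorem setEDist_le_infEDist {A B : Set Z} {a : Z} (ha : a ∈ A) :
    setEDist A B ≤ Metric.infEDist a B :=
  iInf₂_le a ha

theorem le_setEDist {A B : Set Z} {r : ℝ≥0∞} (h : ∀ a ∈ A, r ≤ Metric.infEDist a B) :
    r ≤ setEDist A B :=
  le_iInf₂ h

end SetEDist

/-- The product of a function in `C₀` and a bounded continuous function. -/
def mulC0 {Z : Type*} [TopologicalSpace Z] (k : C₀(Z, ℂ)) (F : Z →ᵇ ℂ) : C₀(Z, ℂ) where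
  toFun z := k z * F z
  continuous_toFun := by fun_prop
  zero_at_infty' := by
    have := k.zero_at_infty'
    refine (this.zero_mul_isBoundedUnder_le ?_)
    exact isBoundedUnder_of ⟨‖F‖, fun z => F.norm_coe_le_norm z⟩

theorem mulC0_toBCF {Z : Type*} [TopologicalSpace Z] (k : C₀(Z, ℂ)) (F : Z →ᵇ ℂ) : (mulC0 k F).toBCF = k.toBCF * F := rfl

section Basic

variable {Z : Type u} [MetricSpace Z] [MeasurableSpace Z] [BorelSpace Z] (μ : Measure Z)

theorem HasFinitePropagation.add {T S : L2 μ →L[ℂ] L2 μ} (hT : HasFinitePropagation μ T)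
    (hS : HasFinitePropagation μ S) : HasFinitePropagation μ (T + S) := by
  obtain ⟨R, hR⟩ := hT
  obtain ⟨R', hR'⟩ := hS
  refine ⟨max R R', fun f g h => ?_⟩
  rw [mul_add, add_mul, hR f g (lt_of_le_of_lt (by simp) h),
    hR' f g (lt_of_le_of_lt (by simp) h), add_zero]

theorem HasFinitePropagation.smul {T : L2 μ →L[ℂ] L2 μ} (c : ℂ) (hT : HasFinitePropagation μ T) :
    HasFinitePropagation μ (c • T) := by
  obtain ⟨R, hR⟩ := hT
  refine ⟨R, fun f g h => ?_⟩
  rw [mul_smul_comm, smul_mul_assoc, hR f g h, smul_zero]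

theorem HasFinitePropagation.star {T : L2 μ →L[ℂ] L2 μ} (hT : HasFinitePropagation μ T) :
    HasFinitePropagation μ (star T) := by
  obtain ⟨R, hR⟩ := hT
  refine ⟨R, fun f g h => ?_⟩
  have hs : ∀ k : C₀(Z, ℂ), tsupport (Star.star k : C₀(Z, ℂ)) ⊆ tsupport k := fun k =>
    closure_mono (Function.support_comp_subset (star_zero ℂ) k)
  have h1 := hR (Star.star g) (Star.star f) (by
    rw [setEDist_comm]
    exact h.trans_le (setEDist_mono (hs f) (hs g)))
  have h2 : ∀ k : C₀(Z, ℂ), (Star.star k : C₀(Z, ℂ)).toBCF = Star.star k.toBCF := fun _ => rfl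
  rw [h2, h2, ← star_mulOp, ← star_mulOp] at h1
  rw [← star_eq_zero, star_mul, star_mul, star_star, ← mul_assoc]
  exact h1

end Basic

section Algebra

variable {Z : Type u} [MetricSpace Z] [LocallyCompactSpace Z] [SigmaCompactSpace Z]
  [MeasurableSpace Z] [BorelSpace Z] (μ : Measure Z)

theorem eq_zero_of_mulOp {v : L2 μ}
    (h : ∀ k : C₀(Z, ℂ), HasCompactSupport k → mulOp μ k.toBCF v = 0) : v = 0 := by
  have hk : ∀ n : ℕ, ∀ᵐ z ∂μ, z ∈ compactCovering Z n → v z = 0 := by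
    intro n
    obtain ⟨f, hf1, -, hfc, -⟩ := exists_continuous_one_zero_of_isCompact
      (isCompact_compactCovering Z n) isClosed_empty (disjoint_empty _)
    let k : C₀(Z, ℂ) :=
      { toFun := fun z => (f z : ℂ)
        continuous_toFun := by fun_prop
        zero_at_infty' := (hfc.comp_left (g := fun r : ℝ => (r : ℂ)) rfl).is_zero_at_infty }
    have hkc : HasCompactSupport k := hfc.comp_left (g := fun r : ℝ => (r : ℂ)) rfl
    have h0 := mulOp_coe μ k.toBCF v
    rw [h k hkc] at h0
    filter_upwards [h0, Lp.coeFn_zero ℂ 2 μ] with z hz1 hz2 hz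
    have hkz : k.toBCF z = 1 := by
      change ((f z : ℝ) : ℂ) = 1
      rw [hf1 hz]; simp
    rw [hz2, hkz, one_mul] at hz1
    exact hz1.symm
  apply Lp.ext
  filter_upwards [ae_all_iff.2 hk, Lp.coeFn_zero ℂ 2 μ] with z hz hz0
  rw [hz0]
  obtain ⟨n, hn⟩ := exists_mem_compactCovering z
  exact hz n hn

theorem eq_zero_of_mulOp_mul {S : L2 μ →L[ℂ] L2 μ}
    (h : ∀ k : C₀(Z, ℂ), HasCompactSupport k → mulOp μ k.toBCF * S = 0) : S = 0 := by
  ext1 ξ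
  exact eq_zero_of_mulOp μ fun k hk => DFunLike.congr_fun (h k hk) ξ

theorem eq_zero_of_mul_mulOp {S : L2 μ →L[ℂ] L2 μ}
    (h : ∀ k : C₀(Z, ℂ), HasCompactSupport k → S * mulOp μ k.toBCF = 0) : S = 0 := by
  rw [← star_eq_zero]
  refine eq_zero_of_mulOp_mul μ fun k hk => ?_
  have h1 := h (star k) (hk.comp_left (g := star) (star_zero ℂ))
  have h2 : (star k).toBCF = star k.toBCF := rfl
  rw [← star_eq_zero, star_mul, star_star, star_mulOp, ← h2]
  exact h1

theorem finProp_bcf {T : L2 μ →L[ℂ] L2 μ} {R : ℝ≥0}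
    (hT : ∀ f g : C₀(Z, ℂ), (R : ℝ≥0∞) < setEDist (tsupport f) (tsupport g) →
      mulOp μ f.toBCF * T * mulOp μ g.toBCF = 0)
    (F G : Z →ᵇ ℂ) (h : (R : ℝ≥0∞) < setEDist (tsupport F) (tsupport G)) :
    mulOp μ F * T * mulOp μ G = 0 := by
  refine eq_zero_of_mulOp_mul μ fun k _ => eq_zero_of_mul_mulOp μ fun l _ => ?_
  have h1 := hT (mulC0 k F) (mulC0 l G) (h.trans_le (setEDist_mono
    (tsupport_mul_subset_right (f := k) (g := F)) (tsupport_mul_subset_right (f := l) (g := G))))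
  rw [mulC0_toBCF, mulC0_toBCF, mul_comm l.toBCF G, mulOp_mul, mulOp_mul] at h1
  simpa only [mul_assoc] using h1

theorem HasFinitePropagation.mul {T S : L2 μ →L[ℂ] L2 μ} (hT : HasFinitePropagation μ T)
    (hS : HasFinitePropagation μ S) : HasFinitePropagation μ (T * S) := by
  obtain ⟨R, hR⟩ := hT
  obtain ⟨R', hR'⟩ := hS
  refine ⟨R + R' + 3, fun f g h => ?_⟩
  set E : Set Z := Metric.cthickening ((R' : ℝ) + 1) (tsupport g) with hE
  let θ : Z →ᵇ ℝ≥0 := thickenedIndicator one_pos E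
  let χ : Z →ᵇ ℂ := BoundedContinuousFunction.ofNormedAddCommGroup (fun z => ((θ z : ℝ) : ℂ))
    (by fun_prop) 1 (fun z => by
      have h1 : θ z ≤ 1 := thickenedIndicator_le_one one_pos E z
      rw [Complex.norm_real, NNReal.norm_eq]
      exact_mod_cast h1)
  have hχ1 : ∀ z ∈ E, χ z = 1 := fun z hz => by
    change ((θ z : ℝ) : ℂ) = 1
    rw [thickenedIndicator_one one_pos E hz]; simp
  have hχ0 : ∀ z ∉ Metric.thickening 1 E, χ z = 0 := fun z hz => by
    change ((θ z : ℝ) : ℂ) = 0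
    rw [thickenedIndicator_zero one_pos E hz]; simp
  have e1 : ENNReal.ofReal ((R' : ℝ) + 1) = R' + 1 := by
    rw [ENNReal.ofReal_add (by positivity) zero_le_one]; simp
  -- points of the support of `χ` are close to the support of `g`
  have hs1 : ∀ z ∈ tsupport χ, Metric.infEDist z (tsupport g) ≤ R' + 2 := by
    have hcl : IsClosed {z | Metric.infEDist z (tsupport g) ≤ (R' : ℝ≥0∞) + 2} :=
      isClosed_le Metric.continuous_infEDist continuous_const
    refine closure_minimal (fun z hz => ?_) hcl
    have hz1 : z ∈ Metric.thickening 1 E := by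
      by_contra hz'
      exact hz (hχ0 z hz')
    obtain ⟨w, hw, hzw⟩ := (Metric.mem_thickening_iff_exists_edist_lt _ _).1 hz1
    have hw' : Metric.infEDist w (tsupport g) ≤ R' + 1 := by
      rw [← e1]; exact hw
    calc Metric.infEDist z (tsupport g)
        ≤ edist z w + Metric.infEDist w (tsupport g) := by
          exact Metric.infEDist_le_edist_add_infEDist
      _ ≤ 1 + (R' + 1) := by
          gcongr
          simpa using hzw.le
      _ = R' + 2 := by ring
  -- points of the support of `1 - χ` are far from the support of `g`
  have hs2 : ∀ z ∈ tsupport (1 - χ : Z →ᵇ ℂ), (R' : ℝ≥0∞) + 1 ≤ Metric.infEDist z (tsupport g) := by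
    have hcl : IsClosed {z | (R' : ℝ≥0∞) + 1 ≤ Metric.infEDist z (tsupport g)} :=
      isClosed_le continuous_const Metric.continuous_infEDist
    refine closure_minimal (fun z hz => ?_) hcl
    by_contra hz'
    apply hz
    have hzE : z ∈ E := by
      rw [hE, Metric.mem_cthickening_iff, e1]
      exact (not_le.1 hz').le
    change (1 : ℂ) - χ z = 0
    rw [hχ1 z hzE, sub_self]
  have d1 : (R : ℝ≥0∞) < setEDist (tsupport f.toBCF) (tsupport χ) := by
    have : (R : ℝ≥0∞) + 1 ≤ setEDist (tsupport f.toBCF) (tsupport χ) := by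
      refine le_iInf₂ fun a ha => le_iInf₂ fun b hb => ?_
      have h1 : ((R + R' + 3 : ℝ≥0) : ℝ≥0∞) ≤ edist a b + (R' + 2) :=
        calc ((R + R' + 3 : ℝ≥0) : ℝ≥0∞) ≤ Metric.infEDist a (tsupport g) :=
              h.le.trans (setEDist_le_infEDist ha)
          _ ≤ edist a b + Metric.infEDist b (tsupport g) :=
              Metric.infEDist_le_edist_add_infEDist
          _ ≤ edist a b + (R' + 2) := by gcongr; exact hs1 b hb
      have h2 : ((R + R' + 3 : ℝ≥0) : ℝ≥0∞) = (R + 1 : ℝ≥0∞) + (R' + 2) := by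
        push_cast; ring
      rw [h2] at h1
      exact (ENNReal.add_le_add_iff_right (by finiteness)).1 h1
    exact lt_of_lt_of_le (ENNReal.lt_add_right (by finiteness) one_ne_zero) this
  have d2 : (R' : ℝ≥0∞) < setEDist (tsupport (1 - χ : Z →ᵇ ℂ)) (tsupport g.toBCF) :=
    lt_of_lt_of_le (ENNReal.lt_add_right (by finiteness) one_ne_zero) (le_setEDist hs2)
  have k1 := finProp_bcf μ hR f.toBCF χ d1
  have k2 := finProp_bcf μ hR' (1 - χ) g.toBCF d2
  have k3 : mulOp μ χ + mulOp μ (1 - χ) = 1 := by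
    rw [← mulOp_add, add_sub_cancel, mulOp_one]
  calc mulOp μ f.toBCF * (T * S) * mulOp μ g.toBCF
      = mulOp μ f.toBCF * T * (mulOp μ χ + mulOp μ (1 - χ)) * S * mulOp μ g.toBCF := by
        rw [k3, mul_one]; simp only [mul_assoc]
    _ = (mulOp μ f.toBCF * T * mulOp μ χ) * S * mulOp μ g.toBCF +
        mulOp μ f.toBCF * T * (mulOp μ (1 - χ) * S * mulOp μ g.toBCF) := by
        simp only [mul_add, add_mul, mul_assoc]
    _ = 0 := by rw [k1, k2]; simp

/-- The Roe `*`-algebra of `Z`, with respect to the module `L²(Z, μ)`: all locally compact bounded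
operators with finite propagation. -/
def roeStarAlgebra : NonUnitalStarSubalgebra ℂ (L2 μ →L[ℂ] L2 μ) where
  carrier := {T | HasFinitePropagation μ T ∧ IsLocallyCompactOp μ T}
  zero_mem' := ⟨⟨0, fun f g _ => by simp⟩, fun f _ => by
    simp only [mul_zero, zero_mul]
    exact ⟨isCompactOperator_zero, isCompactOperator_zero⟩⟩
  add_mem' {T S} hT hS := ⟨hT.1.add μ hS.1, fun f hf => by
    rw [mul_add, add_mul]
    exact ⟨(hT.2 f hf).1.add (hS.2 f hf).1, (hT.2 f hf).2.add (hS.2 f hf).2⟩⟩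
  smul_mem' c T hT := ⟨hT.1.smul μ c, fun f hf => by
    rw [mul_smul_comm, smul_mul_assoc]
    exact ⟨(hT.2 f hf).1.smul c, (hT.2 f hf).2.smul c⟩⟩
  mul_mem' {T S} hT hS := ⟨hT.1.mul μ hS.1, fun f hf => by
    constructor
    · rw [← mul_assoc]
      exact (hT.2 f hf).1.comp_clm S
    · rw [mul_assoc]
      exact (hS.2 f hf).2.clm_comp T⟩
  star_mem' {T} hT := ⟨hT.1.star μ, fun f hf => by
    have hc : HasCompactSupport (star f : C₀(Z, ℂ)) := hf.comp_left (g := star) (star_zero ℂ)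
    have h2 : (star f : C₀(Z, ℂ)).toBCF = star f.toBCF := rfl
    have h3 := hT.2 (star f) hc
    rw [h2, ← star_mulOp] at h3
    constructor
    · have := isCompactOperator_star h3.2
      rwa [star_mul, star_star] at this
    · have := isCompactOperator_star h3.1
      rwa [star_mul, star_star] at this⟩

theorem mem_roeStarAlgebra {T : L2 μ →L[ℂ] L2 μ} :
    T ∈ roeStarAlgebra μ ↔ HasFinitePropagation μ T ∧ IsLocallyCompactOp μ T :=
  Iff.rfl

/-- The maximal Roe algebra of `Z` (with respect to the module `L²(Z, μ)`): the completion of the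
Roe `*`-algebra for its maximal norm, once this norm is finite. -/
abbrev MaxRoeAlgebra (h : MaxNormFinite (roeStarAlgebra μ)) : Type u := MaxCStar h

end Algebra

/-- Bounded (coarse) geometry: for some gauge `ϱ > 0` and every `R > 0` there is `N` such that every
ball of radius `R` is covered by `N` balls of radius `ϱ`. -/
def BoundedGeometry (Z : Type*) [MetricSpace Z] : Prop :=
  ∃ ϱ : ℝ, 0 < ϱ ∧ ∀ R : ℝ, 0 < R → ∃ N : ℕ, ∀ z : Z, ∃ s : Finset Z, s.card ≤ N ∧
    Metric.ball z R ⊆ ⋃ w ∈ s, Metric.ball w ϱ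

end Roe

/-! ## Non-singular Lipschitz actions and the Koopman representation -/

section Koopman

/-- The action of `Γ` on the metric measure space `(Y, μ)` is by Lipschitz maps and it is
non-singular, that is, it preserves the measure class of `μ`. -/
structure IsNonsingularLipschitzAction (Γ : Type v) [Group Γ] {Y : Type u} [MetricSpace Y]
    [MeasurableSpace Y] [MulAction Γ Y] (μ : Measure Y) : Prop where
  lipschitz : ∀ γ : Γ, ∃ K : ℝ≥0, LipschitzWith K fun y : Y => γ • y
  map_absolutelyContinuous : ∀ γ : Γ, μ.map (fun y : Y => γ • y) ≪ μ
  absolutelyContinuous_map : ∀ γ : Γ, μ ≪ μ.map (fun y : Y => γ • y)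

section Cocycle

variable {Γ : Type v} [Group Γ] {Y : Type u} [MeasurableSpace Y] [MulAction Γ Y]

/-- The Radon–Nikodym cocycle `r(γ, y) = d(γ_* μ)/dμ (y)`. -/
def rnCocycle (μ : Measure Y) (γ : Γ) : Y → ℝ≥0∞ := (μ.map fun y : Y => γ • y).rnDeriv μ

theorem measurable_rnCocycle (μ : Measure Y) (γ : Γ) : Measurable (rnCocycle μ γ) :=
  Measure.measurable_rnDeriv _ _

/-- The function `y ↦ r(γ, y)^{1/2} ξ(γ⁻¹ y)`. -/
def koopmanFun (μ : Measure Y) (γ : Γ) (ξ : Y → ℂ) (y : Y) : ℂ :=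
  (Real.sqrt (rnCocycle μ γ y).toReal : ℂ) * ξ (γ⁻¹ • y)

end Cocycle

theorem IsNonsingularLipschitzAction.continuous {Γ : Type v} [Group Γ] {Y : Type u} [MetricSpace Y]
    [MeasurableSpace Y] [MulAction Γ Y] {μ : Measure Y} (h : IsNonsingularLipschitzAction Γ μ)
    (γ : Γ) : Continuous fun y : Y => γ • y :=
  let ⟨_, hK⟩ := h.lipschitz γ
  hK.continuous

variable {Γ : Type v} [Group Γ] {Y : Type u} [MetricSpace Y] [MeasurableSpace Y] [BorelSpace Y]
  [MulAction Γ Y] {μ : Measure Y}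

namespace IsNonsingularLipschitzAction

/-- The homeomorphism `y ↦ γ y`. -/
def homeo (h : IsNonsingularLipschitzAction Γ μ)
    (γ : Γ) : Y ≃ₜ Y where
  toEquiv := MulAction.toPerm γ
  continuous_toFun := h.continuous γ
  continuous_invFun := h.continuous γ⁻¹

theorem quasi (h : IsNonsingularLipschitzAction Γ μ)
    (γ : Γ) : Measure.QuasiMeasurePreserving (fun y : Y => γ • y) μ μ :=
  ⟨(h.continuous γ).measurable, h.map_absolutelyContinuous γ⟩

theorem map_eq_withDensity (h : IsNonsingularLipschitzAction Γ μ)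
    [SigmaFinite μ] (γ : Γ) :
    μ.map (fun y : Y => γ • y) = μ.withDensity (rnCocycle μ γ) := by
  have : SigmaFinite (μ.map (fun y : Y => γ • y)) :=
    MeasurableEquiv.sigmaFinite_map (h.homeo γ).toMeasurableEquiv
  exact (Measure.withDensity_rnDeriv_eq _ _ (h.map_absolutelyContinuous γ)).symm

theorem rnCocycle_lt_top (h : IsNonsingularLipschitzAction Γ μ)
    [SigmaFinite μ] (γ : Γ) : ∀ᵐ y ∂μ, rnCocycle μ γ y < ∞ := by
  have : SigmaFinite (μ.map (fun y : Y => γ • y)) :=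
    MeasurableEquiv.sigmaFinite_map (h.homeo γ).toMeasurableEquiv
  exact Measure.rnDeriv_lt_top _ _

/-- The cocycle identity `r(γγ', y) = r(γ, y) r(γ', γ⁻¹ y)`. -/
theorem rnCocycle_mul (h : IsNonsingularLipschitzAction Γ μ)
    [SigmaFinite μ] (γ γ' : Γ) :
    ∀ᵐ y ∂μ, rnCocycle μ (γ * γ') y = rnCocycle μ γ y * rnCocycle μ γ' (γ⁻¹ • y) := by
  have hm : Measurable fun y : Y => rnCocycle μ γ' (γ⁻¹ • y) :=
    (measurable_rnCocycle μ γ').comp (h.continuous γ⁻¹).measurable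
  have h1 : μ.withDensity (rnCocycle μ (γ * γ')) =
      μ.withDensity (rnCocycle μ γ * fun y => rnCocycle μ γ' (γ⁻¹ • y)) := by
    rw [withDensity_mul _ (measurable_rnCocycle μ γ) hm, ← h.map_eq_withDensity,
      ← h.map_eq_withDensity]
    have h2 : μ.map (fun y : Y => (γ * γ') • y) =
        (μ.map (fun y : Y => γ' • y)).map (fun y : Y => γ • y) := by
      rw [Measure.map_map (h.continuous γ).measurable (h.continuous γ').measurable]
      congr 1
      funext y
      exact mul_smul γ γ' y
    rw [h2, h.map_eq_withDensity γ']
    ext s hs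
    rw [Measure.map_apply (h.continuous γ).measurable hs,
      withDensity_apply _ ((h.continuous γ).measurable hs), withDensity_apply _ hs,
      setLIntegral_map hs hm (h.continuous γ).measurable]
    simp only [inv_smul_smul]
  exact (withDensity_eq_iff_of_sigmaFinite (measurable_rnCocycle μ _).aemeasurable
    ((measurable_rnCocycle μ γ).mul hm).aemeasurable).1 h1

theorem rnCocycle_one (h : IsNonsingularLipschitzAction Γ μ)
    [SigmaFinite μ] : ∀ᵐ y ∂μ, rnCocycle μ (1 : Γ) y = 1 := by
  have h1 : μ.withDensity (rnCocycle μ (1 : Γ)) = μ.withDensity 1 := by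
    rw [← h.map_eq_withDensity, withDensity_one]
    simp
  exact (withDensity_eq_iff_of_sigmaFinite (measurable_rnCocycle μ _).aemeasurable
    aemeasurable_const).1 h1

theorem koopmanFun_congr (h : IsNonsingularLipschitzAction Γ μ)
    (γ : Γ) {ξ η : Y → ℂ} (hξ : ξ =ᵐ[μ] η) :
    koopmanFun μ γ ξ =ᵐ[μ] koopmanFun μ γ η := by
  filter_upwards [(h.quasi γ⁻¹).ae_eq_comp hξ] with y hy
  simp only [Function.comp_apply] at hy
  simp only [koopmanFun, hy]

theorem aestronglyMeasurable_koopmanFun (h : IsNonsingularLipschitzAction Γ μ)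
    (γ : Γ) {ξ : Y → ℂ} (hξ : AEStronglyMeasurable ξ μ) :
    AEStronglyMeasurable (koopmanFun μ γ ξ) μ := by
  refine AEStronglyMeasurable.mul ?_ (hξ.comp_quasiMeasurePreserving (h.quasi γ⁻¹))
  exact (Complex.measurable_ofReal.comp
    (measurable_rnCocycle μ γ).ennreal_toReal.sqrt).aestronglyMeasurable

theorem eLpNorm_koopmanFun (h : IsNonsingularLipschitzAction Γ μ)
    [SigmaFinite μ] (γ : Γ) {ξ : Y → ℂ} (hξ : AEStronglyMeasurable ξ μ) :
    eLpNorm (koopmanFun μ γ ξ) 2 μ = eLpNorm ξ 2 μ := by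
  rw [eLpNorm_eq_lintegral_rpow_enorm_toReal (by simp) (by simp),
    eLpNorm_eq_lintegral_rpow_enorm_toReal (by simp) (by simp)]
  congr 1
  simp only [ENNReal.toReal_ofNat]
  calc ∫⁻ y, ‖koopmanFun μ γ ξ y‖ₑ ^ (2 : ℝ) ∂μ
      = ∫⁻ y, rnCocycle μ γ y * ‖ξ (γ⁻¹ • y)‖ₑ ^ (2 : ℝ) ∂μ := by
        apply lintegral_congr_ae
        filter_upwards [h.rnCocycle_lt_top γ] with y hy
        rw [koopmanFun, enorm_mul, ENNReal.mul_rpow_of_nonneg _ _ zero_le_two]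
        congr 1
        rw [← ofReal_norm, Complex.norm_real, Real.norm_of_nonneg (Real.sqrt_nonneg _),
          ENNReal.ofReal_rpow_of_nonneg (Real.sqrt_nonneg _) zero_le_two, Real.rpow_two,
          Real.sq_sqrt ENNReal.toReal_nonneg, ENNReal.ofReal_toReal hy.ne]
    _ = ∫⁻ y, ‖ξ (γ⁻¹ • y)‖ₑ ^ (2 : ℝ) ∂(μ.withDensity (rnCocycle μ γ)) := by
        rw [lintegral_withDensity_eq_lintegral_mul₀ (measurable_rnCocycle μ γ).aemeasurable]
        · rfl
        · exact ((hξ.comp_quasiMeasurePreserving (h.quasi γ⁻¹)).enorm.pow_const _)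
    _ = ∫⁻ y, ‖ξ (γ⁻¹ • y)‖ₑ ^ (2 : ℝ) ∂(μ.map (fun y : Y => γ • y)) := by
        rw [h.map_eq_withDensity]
    _ = ∫⁻ y, ‖ξ y‖ₑ ^ (2 : ℝ) ∂μ := by
        refine (lintegral_map_equiv (μ := μ) _ (h.homeo γ).toMeasurableEquiv).trans ?_
        apply lintegral_congr
        intro y
        change ‖ξ (γ⁻¹ • (γ • y))‖ₑ ^ (2 : ℝ) = _
        rw [inv_smul_smul]

theorem memLp_koopmanFun (h : IsNonsingularLipschitzAction Γ μ)
    [SigmaFinite μ] (γ : Γ) {ξ : Y → ℂ} (hξ : MemLp ξ 2 μ) :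
    MemLp (koopmanFun μ γ ξ) 2 μ :=
  ⟨h.aestronglyMeasurable_koopmanFun γ hξ.1, by rw [h.eLpNorm_koopmanFun γ hξ.1]; exact hξ.2⟩

/-- The isometry `ξ ↦ r(γ, ·)^{1/2} ξ(γ⁻¹ ·)` of `L²(Y, μ)`. -/
def koopmanIsometry (h : IsNonsingularLipschitzAction Γ μ)
    [SigmaFinite μ] (γ : Γ) : L2 μ →ₗᵢ[ℂ] L2 μ where
  toFun ξ := (h.memLp_koopmanFun γ (Lp.memLp ξ)).toLp
  map_add' ξ η := by
    rw [← MemLp.toLp_add]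
    apply MemLp.toLp_congr
    refine (h.koopmanFun_congr γ (Lp.coeFn_add ξ η)).trans (.of_forall fun y => ?_)
    simp [koopmanFun, mul_add]
  map_smul' c ξ := by
    rw [RingHom.id_apply, ← MemLp.toLp_const_smul]
    apply MemLp.toLp_congr
    refine (h.koopmanFun_congr γ (Lp.coeFn_smul c ξ)).trans (.of_forall fun y => ?_)
    simp [koopmanFun]
    ring
  norm_map' ξ := by
    change ‖(h.memLp_koopmanFun γ (Lp.memLp ξ)).toLp‖ = _
    rw [Lp.norm_toLp, h.eLpNorm_koopmanFun γ (Lp.aestronglyMeasurable ξ), Lp.norm_def]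

theorem koopmanIsometry_coe (h : IsNonsingularLipschitzAction Γ μ)
    [SigmaFinite μ] (γ : Γ) (ξ : L2 μ) :
    h.koopmanIsometry γ ξ =ᵐ[μ] koopmanFun μ γ ξ :=
  (h.memLp_koopmanFun γ (Lp.memLp ξ)).coeFn_toLp

/-- The Koopman representation by bounded operators. -/
def koopmanHom (h : IsNonsingularLipschitzAction Γ μ)
    [SigmaFinite μ] : Γ →* (L2 μ →L[ℂ] L2 μ) where
  toFun γ := (h.koopmanIsometry γ).toContinuousLinearMap
  map_one' := by
    ext1 ξ
    apply Lp.ext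
    refine (h.koopmanIsometry_coe 1 ξ).trans ?_
    filter_upwards [h.rnCocycle_one] with y hy
    simp [koopmanFun, hy]
  map_mul' γ γ' := by
    ext1 ξ
    apply Lp.ext
    refine (h.koopmanIsometry_coe (γ * γ') ξ).trans ?_
    refine EventuallyEq.trans ?_ (h.koopmanIsometry_coe γ (h.koopmanIsometry γ' ξ)).symm
    refine EventuallyEq.trans ?_ (h.koopmanFun_congr γ (h.koopmanIsometry_coe γ' ξ)).symm
    filter_upwards [h.rnCocycle_mul γ γ'] with y hy
    simp only [koopmanFun, hy, mul_inv_rev, mul_smul, ENNReal.toReal_mul,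
      Real.sqrt_mul ENNReal.toReal_nonneg, Complex.ofReal_mul, mul_assoc]

/-- The Koopman representation `π_α : Γ → U(L²(Y, μ))`,
`(π_α(γ) ξ)(y) = r(γ, y)^{1/2} ξ(γ⁻¹ y)`. -/
def koopman (h : IsNonsingularLipschitzAction Γ μ)
    [SigmaFinite μ] : Γ →* unitary (L2 μ →L[ℂ] L2 μ) :=
  h.koopmanHom.codRestrict (unitary (L2 μ →L[ℂ] L2 μ)) fun γ => by
    have h1 : star (h.koopmanHom γ) * h.koopmanHom γ = 1 :=
      (ContinuousLinearMap.norm_map_iff_adjoint_comp_self _).1 (h.koopmanIsometry γ).norm_map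
    have h2 : h.koopmanHom γ * h.koopmanHom γ⁻¹ = 1 := by
      rw [← map_mul, mul_inv_cancel, map_one]
    have h3 : star (h.koopmanHom γ) = h.koopmanHom γ⁻¹ := by
      rw [← mul_one (star _), ← h2, ← mul_assoc, h1, one_mul]
    exact Unitary.mem_iff.2 ⟨h1, by rw [h3, h2]⟩

theorem koopman_coe (h : IsNonsingularLipschitzAction Γ μ)
    [SigmaFinite μ] (γ : Γ) (ξ : L2 μ) :
    (h.koopman γ : L2 μ →L[ℂ] L2 μ) ξ =ᵐ[μ] koopmanFun μ γ ξ :=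
  h.koopmanIsometry_coe γ ξ

/-- The function `y ↦ f(γ y)` in `C₀(Y)`. -/
def precomp (h : IsNonsingularLipschitzAction Γ μ)
    (γ : Γ) (f : C₀(Y, ℂ)) : C₀(Y, ℂ) where
  toFun y := f (γ • y)
  continuous_toFun := f.continuous.comp (h.continuous γ)
  zero_at_infty' := f.zero_at_infty'.comp (h.homeo γ).isClosedEmbedding.tendsto_cocompact

theorem tsupport_precomp (h : IsNonsingularLipschitzAction Γ μ)
    (γ : Γ) (f : C₀(Y, ℂ)) {y : Y} (hy : y ∈ tsupport (h.precomp γ f)) :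
    γ • y ∈ tsupport f :=
  closure_minimal (t := (fun y : Y => γ • y) ⁻¹' tsupport f)
    (fun _ hz => subset_tsupport f hz) ((isClosed_tsupport f).preimage (h.continuous γ)) hy

theorem hasCompactSupport_precomp (h : IsNonsingularLipschitzAction Γ μ)
    (γ : Γ) {f : C₀(Y, ℂ)} (hf : HasCompactSupport f) :
    HasCompactSupport (h.precomp γ f) :=
  hf.comp_homeomorph (h.homeo γ)

theorem mulOp_koopman (h : IsNonsingularLipschitzAction Γ μ)
    [SigmaFinite μ] (γ : Γ) (f : C₀(Y, ℂ)) :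
    mulOp μ f.toBCF * (h.koopman γ : L2 μ →L[ℂ] L2 μ) =
      (h.koopman γ : L2 μ →L[ℂ] L2 μ) * mulOp μ (h.precomp γ f).toBCF := by
  ext1 ξ
  apply Lp.ext
  refine (mulOp_coe μ f.toBCF (h.koopman γ • ξ)).trans ?_
  refine EventuallyEq.trans ?_ (h.koopman_coe γ (mulOp μ (h.precomp γ f).toBCF ξ)).symm
  refine EventuallyEq.trans ?_ (h.koopmanFun_congr γ (mulOp_coe μ _ ξ)).symm
  filter_upwards [h.koopman_coe γ ξ] with y hy
  refine (congrArg (f y * ·) hy).trans ?_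
  have h1 : (h.precomp γ f).toBCF (γ⁻¹ • y) = f y := by
    change f (γ • γ⁻¹ • y) = f y
    rw [smul_inv_smul]
  simp only [koopmanFun, h1]
  ring

theorem koopman_mulOp (h : IsNonsingularLipschitzAction Γ μ)
    [SigmaFinite μ] (γ : Γ) (f : C₀(Y, ℂ)) :
    star (h.koopman γ : L2 μ →L[ℂ] L2 μ) * mulOp μ f.toBCF =
      mulOp μ (h.precomp γ f).toBCF * star (h.koopman γ : L2 μ →L[ℂ] L2 μ) := by
  have h1 := congrArg star (h.mulOp_koopman γ (star f))
  have h2 : (star f : C₀(Y, ℂ)).toBCF = star f.toBCF := rfl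
  have h3 : (h.precomp γ (star f)).toBCF = star (h.precomp γ f).toBCF := rfl
  rw [star_mul, star_mul, h2, h3, ← star_mulOp, ← star_mulOp, star_star, star_star] at h1
  exact h1

/-- Conjugation by the Koopman representation preserves the Roe `*`-algebra. -/
theorem conj_mem_roeStarAlgebra (h : IsNonsingularLipschitzAction Γ μ)
    [LocallyCompactSpace Y] [SigmaCompactSpace Y] [SigmaFinite μ]
    (γ : Γ) {T : L2 μ →L[ℂ] L2 μ} (hT : T ∈ roeStarAlgebra μ) :
    (h.koopman γ : L2 μ →L[ℂ] L2 μ) * T * star (h.koopman γ : L2 μ →L[ℂ] L2 μ) ∈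
      roeStarAlgebra μ := by
  set U : L2 μ →L[ℂ] L2 μ := (h.koopman γ : L2 μ →L[ℂ] L2 μ) with hU
  obtain ⟨⟨R, hR⟩, hc⟩ := hT
  refine ⟨?_, fun f hf => ?_⟩
  · obtain ⟨K, hK⟩ := h.lipschitz γ
    refine ⟨K * (R + 1), fun f g hfg => ?_⟩
    have hd : (R : ℝ≥0∞) < setEDist (tsupport (h.precomp γ f)) (tsupport (h.precomp γ g)) := by
      have h1 : (R : ℝ≥0∞) + 1 ≤
          setEDist (tsupport (h.precomp γ f)) (tsupport (h.precomp γ g)) := by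
        refine le_iInf₂ fun a ha => le_iInf₂ fun b hb => ?_
        have h2 : (K : ℝ≥0∞) * (R + 1) < K * edist a b := by
          have h3 : setEDist (tsupport f) (tsupport g) ≤ edist (γ • a) (γ • b) :=
            (iInf₂_le _ (h.tsupport_precomp γ f ha)).trans
              (iInf₂_le _ (h.tsupport_precomp γ g hb))
          refine lt_of_lt_of_le ?_ (h3.trans (hK a b))
          exact_mod_cast hfg
        exact (lt_of_mul_lt_mul_left' h2).le
      exact lt_of_lt_of_le (ENNReal.lt_add_right (by finiteness) one_ne_zero) h1
    have h4 := hR _ _ hd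
    calc mulOp μ f.toBCF * (U * T * star U) * mulOp μ g.toBCF
        = (mulOp μ f.toBCF * U) * T * (star U * mulOp μ g.toBCF) := by simp only [mul_assoc]
      _ = U * (mulOp μ (h.precomp γ f).toBCF * T * mulOp μ (h.precomp γ g).toBCF) * star U := by
          rw [hU, h.mulOp_koopman, h.koopman_mulOp]; simp only [mul_assoc]
      _ = 0 := by rw [h4]; simp
  · have h5 := hc (h.precomp γ f) (h.hasCompactSupport_precomp γ hf)
    constructor
    · have h6 : mulOp μ f.toBCF * (U * T * star U) =
          U * (mulOp μ (h.precomp γ f).toBCF * T) * star U := by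
        rw [← mul_assoc, ← mul_assoc, hU, h.mulOp_koopman]; simp only [mul_assoc]
      rw [h6]
      exact (h5.1.clm_comp U).comp_clm (star U)
    · have h6 : (U * T * star U) * mulOp μ f.toBCF =
          U * (T * mulOp μ (h.precomp γ f).toBCF) * star U := by
        rw [mul_assoc, hU, h.koopman_mulOp]; simp only [mul_assoc]
      rw [h6]
      exact (h5.2.clm_comp U).comp_clm (star U)

/-- The action `γ · T = π_α(γ) T π_α(γ)*` of `Γ` on the Roe `*`-algebra. -/
def roeAction (h : IsNonsingularLipschitzAction Γ μ)
    [LocallyCompactSpace Y] [SigmaCompactSpace Y] [SigmaFinite μ] :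
    Γ →* (roeStarAlgebra μ →⋆ₙₐ[ℂ] roeStarAlgebra μ) where
  toFun γ :=
    { toFun := fun T => ⟨(h.koopman γ : L2 μ →L[ℂ] L2 μ) * T * star (h.koopman γ : L2 μ →L[ℂ] L2 μ),
        h.conj_mem_roeStarAlgebra γ T.2⟩
      map_smul' := fun c T => Subtype.ext (by simp)
      map_zero' := Subtype.ext (by simp)
      map_add' := fun S T => Subtype.ext (by simp [mul_add, add_mul])
      map_mul' := fun S T => Subtype.ext (by
        have h1 : star (h.koopman γ : L2 μ →L[ℂ] L2 μ) * (h.koopman γ : L2 μ →L[ℂ] L2 μ) = 1 :=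
          Unitary.coe_star_mul_self _
        simp only [NonUnitalStarSubalgebra.coe_mul]
        calc _ = (h.koopman γ : L2 μ →L[ℂ] L2 μ) * S * 1 * T *
              star (h.koopman γ : L2 μ →L[ℂ] L2 μ) := by simp only [mul_one, mul_assoc]
          _ = _ := by rw [← h1]; simp only [mul_assoc])
      map_star' := fun T => Subtype.ext (by simp [mul_assoc]) }
  map_one' := by
    ext1 T
    exact Subtype.ext (by simp)
  map_mul' γ γ' := by
    ext1 T
    refine Subtype.ext ?_
    change ((h.koopman (γ * γ') : unitary _) : L2 μ →L[ℂ] L2 μ) * T * star _ =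
      (h.koopman γ : L2 μ →L[ℂ] L2 μ) * ((h.koopman γ' : L2 μ →L[ℂ] L2 μ) * T *
        star (h.koopman γ' : L2 μ →L[ℂ] L2 μ)) * star (h.koopman γ : L2 μ →L[ℂ] L2 μ)
    rw [map_mul, Submonoid.coe_mul, star_mul]
    simp only [mul_assoc]

/-- The action of `Γ` on the maximal Roe algebra that extends the one on the Roe `*`-algebra. -/
def maxRoeAction (h : IsNonsingularLipschitzAction Γ μ)
    [LocallyCompactSpace Y] [SigmaCompactSpace Y] [SigmaFinite μ]
    (hmax : MaxNormFinite (roeStarAlgebra μ)) :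
    Γ →* (MaxRoeAlgebra μ hmax →⋆ₙₐ[ℂ] MaxRoeAlgebra μ hmax) :=
  MaxCStar.mapAction hmax h.roeAction

end IsNonsingularLipschitzAction

end Koopman

/-! ## Warped metrics -/

section Warped

/-- A proper length function on the group `Γ`. -/
structure ProperLength (Γ : Type v) [Group Γ] where
  toFun : Γ → ℝ
  nonneg : ∀ γ, 0 ≤ toFun γ
  eq_zero_iff : ∀ γ, toFun γ = 0 ↔ γ = 1
  symm : ∀ γ, toFun γ⁻¹ = toFun γ
  subadditive : ∀ γ γ', toFun (γ * γ') ≤ toFun γ + toFun γ'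
  proper : ∀ r : ℝ, {γ | toFun γ ≤ r}.Finite

variable {Γ : Type v} [Group Γ]

instance : CoeFun (ProperLength Γ) fun _ => Γ → ℝ := ⟨ProperLength.toFun⟩

/-- `m` is a metric on the set `Y`. -/
structure IsMetric {Y : Type u} (m : Y → Y → ℝ) : Prop where
  eq_zero_iff : ∀ x y, m x y = 0 ↔ x = y
  symm : ∀ x y, m x y = m y x
  triangle : ∀ x y z, m x z ≤ m x y + m y z

/-- The metrics `m` on `Y` with `m ≤ d` and `m(y, γ y) ≤ ℓ(γ)`. -/
structure IsWarpAdmissible (ℓ : ProperLength Γ) {Y : Type u} [MetricSpace Y] [MulAction Γ Y]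
    (m : Y → Y → ℝ) : Prop where
  isMetric : IsMetric m
  le_dist : ∀ x y, m x y ≤ dist x y
  le_length : ∀ (γ : Γ) (y : Y), m y (γ • y) ≤ ℓ γ

/-- The warped metric `δ_Γ`, the largest of the admissible metrics
(see `isGreatest_warpedDist`). -/
def warpedDist (ℓ : ProperLength Γ) {Y : Type u} [MetricSpace Y] [MulAction Γ Y] (x y : Y) : ℝ :=
  ⨆ m : {m : Y → Y → ℝ // IsWarpAdmissible ℓ m}, m.1 x y

theorem ProperLength.exists_gap (ℓ : ProperLength Γ) :
    ∃ c : ℝ, 0 < c ∧ ∀ γ : Γ, γ ≠ 1 → c ≤ ℓ γ := by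
  have hf : ({γ | ℓ γ ≤ 1} \ {1}).Finite := (ℓ.proper 1).subset sdiff_subset
  rcases (({γ | ℓ γ ≤ 1} \ {1} : Set Γ)).eq_empty_or_nonempty with he | hne
  · refine ⟨1, one_pos, fun γ hγ => ?_⟩
    by_contra hlt
    have : γ ∈ ({γ | ℓ γ ≤ 1} \ {1} : Set Γ) := ⟨(not_le.1 hlt).le, hγ⟩
    rw [he] at this
    exact this
  · obtain ⟨γ₀, hγ₀, hmin⟩ := hf.exists_minimalFor ℓ.toFun _ hne
    refine ⟨ℓ γ₀, lt_of_le_of_ne (ℓ.nonneg _) fun h0 => hγ₀.2 ((ℓ.eq_zero_iff γ₀).1 h0.symm),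
      fun γ hγ => ?_⟩
    by_cases h1 : ℓ γ ≤ 1
    · rcases le_total (ℓ γ₀) (ℓ γ) with h | h
      · exact h
      · exact hmin ⟨h1, hγ⟩ h
    · exact hγ₀.1.trans (not_le.1 h1).le

variable (ℓ : ProperLength Γ) {Y : Type u} [MetricSpace Y] [MulAction Γ Y]

theorem isWarpAdmissible_min {c : ℝ} (hc : 0 < c) (h : ∀ γ : Γ, γ ≠ 1 → c ≤ ℓ γ) :
    IsWarpAdmissible ℓ fun x y : Y => min (dist x y) c where
  isMetric :=
    { eq_zero_iff := fun x y => by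
        constructor
        · intro h0
          rcases min_choice (dist x y) c with h1 | h1
          · exact dist_eq_zero.1 (h1.symm.trans h0)
          · exact absurd (h1.symm.trans h0) hc.ne'
        · rintro rfl
          simp [hc.le]
      symm := fun x y => by rw [dist_comm]
      triangle := fun x y z => by
        have := dist_triangle x y z
        have h1 := dist_nonneg (x := x) (y := y)
        have h2 := dist_nonneg (x := y) (y := z)
        rcases min_cases (dist x y) c with h3 | h3 <;> rcases min_cases (dist y z) c with h4 | h4 <;>
          rcases min_cases (dist x z) c with h5 | h5 <;> linarith }
  le_dist x y := min_le_left _ _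
  le_length γ y := by
    by_cases hγ : γ = 1
    · subst hγ
      simp [hc.le, ℓ.nonneg]
    · exact (min_le_right _ _).trans (h γ hγ)

theorem bddAbove_admissible (x y : Y) :
    BddAbove (Set.range fun m : {m : Y → Y → ℝ // IsWarpAdmissible ℓ m} => m.1 x y) :=
  ⟨dist x y, by rintro _ ⟨m, rfl⟩; exact m.2.le_dist x y⟩

theorem le_warpedDist {m : Y → Y → ℝ} (hm : IsWarpAdmissible ℓ m) (x y : Y) :
    m x y ≤ warpedDist ℓ x y :=
  le_ciSup (bddAbove_admissible ℓ x y) ⟨m, hm⟩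

instance : Nonempty {m : Y → Y → ℝ // IsWarpAdmissible ℓ m} :=
  let ⟨_, hc, h⟩ := ℓ.exists_gap
  ⟨⟨_, isWarpAdmissible_min ℓ hc h⟩⟩

theorem isWarpAdmissible_warpedDist : IsWarpAdmissible ℓ (warpedDist ℓ : Y → Y → ℝ) where
  isMetric :=
    { eq_zero_iff := fun x y => by
        obtain ⟨c, hc, h⟩ := ℓ.exists_gap
        have hm := isWarpAdmissible_min (Y := Y) ℓ hc h
        constructor
        · intro h0
          apply (hm.isMetric.eq_zero_iff x y).1
          apply le_antisymm
          · exact (le_warpedDist ℓ hm x y).trans h0.le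
          · exact le_min dist_nonneg hc.le
        · rintro rfl
          have : ∀ m : {m : Y → Y → ℝ // IsWarpAdmissible ℓ m}, m.1 x x = 0 := fun m =>
            (m.2.isMetric.eq_zero_iff x x).2 rfl
          simp [warpedDist, this]
      symm := fun x y => iSup_congr fun m => m.2.isMetric.symm x y
      triangle := fun x y z => ciSup_le fun m => (m.2.isMetric.triangle x y z).trans
        (add_le_add (le_warpedDist ℓ m.2 x y) (le_warpedDist ℓ m.2 y z)) }
  le_dist x y := ciSup_le fun m => m.2.le_dist x y
  le_length γ y := ciSup_le fun m => m.2.le_length γ y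

/-- `δ_Γ` is the largest metric with `δ_Γ ≤ d` and `δ_Γ(y, γ y) ≤ ℓ(γ)`. -/
theorem isGreatest_warpedDist :
    IsGreatest {m : Y → Y → ℝ | IsWarpAdmissible ℓ m} (warpedDist ℓ) :=
  ⟨isWarpAdmissible_warpedDist ℓ, fun _ hm x y => le_warpedDist ℓ hm x y⟩

/-- The metric space structure given by the warped metric, with the topology it induces. -/
abbrev warpedMetricSpace (Y : Type u) [MetricSpace Y] [MulAction Γ Y] : MetricSpace Y where
  dist := warpedDist ℓ
  dist_self x := ((isWarpAdmissible_warpedDist ℓ).isMetric.eq_zero_iff x x).2 rfl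
  dist_comm := (isWarpAdmissible_warpedDist ℓ).isMetric.symm
  dist_triangle := (isWarpAdmissible_warpedDist ℓ).isMetric.triangle
  eq_of_dist_eq_zero {x y} h := ((isWarpAdmissible_warpedDist ℓ).isMetric.eq_zero_iff x y).1 h

/-- The warped metric and the original metric induce the same topology. -/
theorem warped_topology_eq :
    (inferInstance : TopologicalSpace Y) =
      (warpedMetricSpace ℓ Y).toPseudoMetricSpace.toUniformSpace.toTopologicalSpace := by
  obtain ⟨c, hc, h⟩ := ℓ.exists_gap
  have hm := isWarpAdmissible_min (Y := Y) ℓ hc h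
  refine TopologicalSpace.ext_nhds fun x => ?_
  have b1 := Metric.nhds_basis_ball (x := x)
  have b2 := @Metric.nhds_basis_ball Y (warpedMetricSpace ℓ Y).toPseudoMetricSpace x
  refine b1.ext b2 (fun ε hε => ⟨min ε c, lt_min hε hc, fun y hy => ?_⟩)
    (fun ε hε => ⟨ε, hε, fun y hy => ?_⟩)
  · have hy' : warpedDist ℓ y x < min ε c := hy
    have h1 := (le_warpedDist ℓ hm y x).trans_lt hy'
    rw [Metric.mem_ball]
    rcases min_lt_iff.1 (h1.trans_le (min_le_left ε c)) with h3 | h3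
    · exact h3
    · rcases min_lt_iff.1 (h1.trans_le (min_le_right ε c)) with h4 | h4
      · rw [min_def] at h1
        split_ifs at h1 with h5
        · exact h1.trans_le (min_le_left ε c)
        · exact absurd h4.le h5
      · exact absurd h4 (lt_irrefl c)
  · exact ((isWarpAdmissible_warpedDist ℓ).le_dist y x).trans_lt hy

/-- The space `Y`, equipped with the warped metric `δ_Γ`. -/
def Warped (_ℓ : ProperLength Γ) (Y : Type u) : Type u := Y

namespace Warped

instance : MetricSpace (Warped ℓ Y) :=
  (warpedMetricSpace ℓ Y).replaceTopology (warped_topology_eq ℓ)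

theorem dist_eq (x y : Y) : @dist (Warped ℓ Y) _ x y = warpedDist ℓ x y := rfl

instance [MeasurableSpace Y] : MeasurableSpace (Warped ℓ Y) := ‹MeasurableSpace Y›

instance [MeasurableSpace Y] [BorelSpace Y] : BorelSpace (Warped ℓ Y) := ‹BorelSpace Y›

instance [LocallyCompactSpace Y] : LocallyCompactSpace (Warped ℓ Y) := ‹LocallyCompactSpace Y›

instance [SigmaCompactSpace Y] : SigmaCompactSpace (Warped ℓ Y) := ‹SigmaCompactSpace Y›

/-- The measure `μ`, regarded as a measure on the warped space. -/
def measure {Y : Type u} [MeasurableSpace Y] (μ : Measure Y) : Measure (Warped ℓ Y) := μ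

end Warped

end Warped

end

/-! Write `A` for the Roe `*`-algebra of `d`, `A'` for that of `δ_Γ` and `U γ` for the Koopman
unitaries. A `*`-homomorphism is automatically contractive on a complete `*`-algebra, but `A` and
`A'` are not complete. The C⋆-identity makes up for this: `‖π x‖` depends only on `π (x* x)`, or
only on `π (x x*)`.

Finiteness on `A`. Split `Y` into uniformly bounded measurable cells, the fibres of a retraction `p`
onto a separated net. The block diagonal operators with compact blocks form a C⋆-algebra `D` inside
`A`. Given `T` in `A`, the operator `T* T` has finite propagation, and bounded geometry lets one
colour the cells by finitely many colours so that distinct cells of one colour are out of its reach.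
If `P_k` projects onto the cells of colour `k`, then `(T P_k)* (T P_k) = P_k T* T P_k` lies in `D`,
so `‖π (T P_k)‖ ≤ ‖T P_k‖`, and `T = ∑ T P_k`. This is `maxNormFinite_roeStarAlgebra`.

Generation of `A'`. A warped ball around `x` lies in finitely many `d`-balls of a common radius
around points `γ x`, with `γ` in a finite set independent of `x`
(`exists_finset_dist_le_of_warpedDist_le`). Cut `T` in `A'` by colours as before, now separating
cells for `δ_Γ`. In one coloured piece the row point determines the cell of the column point, so the
rows can be split according to which `γ` carries that cell near the row point. Each resulting piece
is supported near the graph of one `γ`, hence equals `S * U γ` with `S` in `A`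
(`mem_closure_mul_koopman_of_mem_warpedRoeStarAlgebra`).

Conclusion. Since `(S U γ) (S U γ)* = S S*`, the norms of `S U γ` in all representations of `A'` are
bounded by the maximal norm of `S` in `A`; hence the maximal norm of `A'` is finite too. Right
multiplication by `U γ` extends isometrically to the completion, and `(S, γ) ↦ S U γ` defines a
`*`-homomorphism on the full crossed product (`exists_fullCrossedProduct_hom`). Its range contains
the image of `A'`, so it is dense, and `*`-homomorphisms between C⋆-algebras have closed range. -/

noncomputable section

/-! ### Closed range of `*`-homomorphisms between C⋆-algebras -/

section ClosedRange

variable {A : Type*} {B : Type*} [NonUnitalCStarAlgebra A] [NonUnitalCStarAlgebra B]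

/-- Clip `a` to `[-r, r]` by functional calculus, where `r = ‖φ a‖`. Functional calculus commutes
with `φ`, and clipping does nothing to `φ a`, whose spectrum already lies in that interval. -/
theorem NonUnitalStarAlgHom.exists_selfAdjoint_preimage_norm_le (φ : A →⋆ₙₐ[ℂ] B) {a : A}
    (ha : IsSelfAdjoint a) : ∃ a', φ a' = φ a ∧ ‖a'‖ ≤ ‖φ a‖ := by
  set r := ‖φ a‖ with hr
  have hr0 : 0 ≤ r := norm_nonneg _
  let f : ℝ → ℝ := fun t => max (-r) (min t r)
  have hf : Continuous f := by fun_prop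
  have hf0 : f 0 = 0 := by simp [f, hr0]
  have hb : IsSelfAdjoint (φ a) := ha.map φ
  have hφ : Continuous φ := AddMonoidHomClass.continuous_of_bound φ 1 fun x => by
    rw [one_mul]; exact NonUnitalStarAlgHom.norm_apply_le φ x
  refine ⟨cfcₙ f a, ?_, norm_cfcₙ_le fun x _ => ?_⟩
  · rw [NonUnitalStarAlgHomClass.map_cfcₙ (R := ℝ) (S := ℂ) φ f a hf.continuousOn hf0 hφ ha hb]
    conv_rhs => rw [← cfcₙ_id ℝ (φ a) hb]
    refine cfcₙ_congr fun x hx => ?_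
    have h1 := norm_apply_le_norm_cfcₙ (id : ℝ → ℝ) (φ a) hx
    rw [cfcₙ_id ℝ (φ a) hb, ← hr, Real.norm_eq_abs, abs_le] at h1
    simp only [id] at h1
    simp [f, h1.1, h1.2]
  · rw [Real.norm_eq_abs, abs_le]
    exact ⟨le_max_left _ _, max_le (by linarith) (min_le_right _ _)⟩

/-- Real and imaginary parts are corrected separately, which costs the factor `2`. Closedness of the
range needs only some uniform constant. -/
theorem NonUnitalStarAlgHom.exists_preimage_norm_le (φ : A →⋆ₙₐ[ℂ] B) (a : A) :
    ∃ a', φ a' = φ a ∧ ‖a'‖ ≤ 2 * ‖φ a‖ := by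
  obtain ⟨x, hx, hxn⟩ := φ.exists_selfAdjoint_preimage_norm_le (realPart a).2
  obtain ⟨y, hy, hyn⟩ := φ.exists_selfAdjoint_preimage_norm_le (imaginaryPart a).2
  have key : ∀ b : A, φ (realPart b : A) = realPart (φ b) ∧
      φ (imaginaryPart b : A) = imaginaryPart (φ b) := fun b => by
    simp only [realPart_apply_coe, imaginaryPart_apply_coe, map_smul, map_add, map_sub, map_star,
      ← Complex.coe_smul, and_self]
  refine ⟨x + Complex.I • y, ?_, ?_⟩
  · rw [map_add, map_smul, hx, hy, ← map_smul, ← map_add, realPart_add_I_smul_imaginaryPart]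
  · rw [(key a).1] at hxn
    rw [(key a).2] at hyn
    calc ‖x + Complex.I • y‖ ≤ ‖x‖ + ‖Complex.I • y‖ := norm_add_le _ _
      _ = ‖x‖ + ‖y‖ := by rw [norm_smul, Complex.norm_I, one_mul]
      _ ≤ ‖φ a‖ + ‖φ a‖ := add_le_add (hxn.trans (realPart.norm_le (φ a)))
          (hyn.trans (imaginaryPart.norm_le (φ a)))
      _ = 2 * ‖φ a‖ := by ring

/-- A `*`-homomorphism between C⋆-algebras has closed range, so it is surjective as soon as its
range is dense. -/
theorem NonUnitalStarAlgHom.surjective_of_denseRange (φ : A →⋆ₙₐ[ℂ] B) (h : DenseRange φ) :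
    Function.Surjective φ := by
  let f : NormedAddGroupHom A B :=
    { toFun := φ
      map_add' := map_add φ
      bound' := ⟨1, fun x => by rw [one_mul]; exact NonUnitalStarAlgHom.norm_apply_le φ x⟩ }
  have h1 : f.SurjectiveOnWith f.range 2 := by
    rintro _ ⟨a, rfl⟩
    exact φ.exists_preimage_norm_le a
  intro b
  -- Preimages of controlled norm for points of the range are summed along a rapidly convergent
  -- series to reach points of its closure. The loss `1` in the constant is arbitrary.
  have h2 := controlled_closure_of_complete two_pos one_pos h1 b (by
    change b ∈ closure (f.range : Set B)
    exact h b)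
  exact ⟨h2.choose, h2.choose_spec.1⟩

end ClosedRange

/-! ### Representations in different universes -/

section MaxNorm

/-- Every `*`-representation on a Hilbert space, in whatever universe, is contractive for the
maximal norm, provided that the universe of the algebra contains that of the Hilbert space. -/
theorem norm_le_maxNorm_of_hilbert {A : Type (max u v)} [NonUnitalRing A] [StarRing A] [Module ℂ A]
    (h : MaxNormFinite A) {H : Type u} [NormedAddCommGroup H] [InnerProductSpace ℂ H]
    [CompleteSpace H] (π : A →⋆ₙₐ[ℂ] (H →L[ℂ] H)) (x : A) : ‖π x‖ ≤ maxNorm A x := by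
  -- The one-term `ℓ²`-sum is an isometric copy of `H` in the universe over which `maxNorm` takes
  -- its supremum.
  let K : Type (max u v) := PiLp 2 fun _ : PUnit.{v + 1} => H
  let e : K ≃ₗᵢ[ℂ] H :=
    { toLinearEquiv := (PiLp.equivOfUnique 2 ℂ fun _ : PUnit.{v + 1} => H).toLinearEquiv
      norm_map' := fun x => by
        rw [PiLp.norm_eq_of_L2]
        simp
        rfl }
  let c := e.symm.conjStarAlgEquiv
  let ψ : (H →L[ℂ] H) →⋆ₙₐ[ℂ] (K →L[ℂ] K) := c
  let ψ' : (K →L[ℂ] K) →⋆ₙₐ[ℂ] (H →L[ℂ] H) := c.symm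
  have h1 : ψ' (ψ (π x)) = π x := c.symm_apply_apply _
  calc ‖π x‖ = ‖ψ' (ψ (π x))‖ := by rw [h1]
    _ ≤ ‖ψ (π x)‖ := NonUnitalStarAlgHom.norm_apply_le ψ' _
    _ ≤ maxNorm A x := norm_rep_le h { H := K, π := ψ.comp π } x

variable {A : Type u} [NonUnitalRing A] [StarRing A] [Module ℂ A]

/-- A maximal completion is contained in a product of algebras of operators on Hilbert spaces, so a
`*`-homomorphism into it is contractive for the maximal norm. -/
theorem norm_le_maxNorm_of_maxCStar {E : Type (max u v)} [NonUnitalRing E] [StarRing E] [Module ℂ E]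
    (hE : MaxNormFinite E) (h : MaxNormFinite A) (φ : E →⋆ₙₐ[ℂ] MaxCStar h) (x : E) :
    ‖φ x‖ ≤ maxNorm E x := by
  have h0 : 0 ≤ maxNorm E x := (norm_nonneg _).trans
    (norm_rep_le hE (Classical.arbitrary (HilbertRep E)) x)
  refine lp.norm_le_of_forall_le (E := fun p : RepSeminorm A => p.rep.H →L[ℂ] p.rep.H) h0
    fun p => ?_
  -- The coordinate at `p` of the product containing `MaxCStar h` turns `φ` into a representation of
  -- `E`.
  let π : E →⋆ₙₐ[ℂ] (p.rep.H →L[ℂ] p.rep.H) :=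
    { toFun := fun y => (φ y).1.1 p
      map_smul' := fun c y => by rw [map_smul]; rfl
      map_zero' := by rw [map_zero]; rfl
      map_add' := fun y z => by rw [map_add]; rfl
      map_mul' := fun y z => by rw [map_mul]; rfl
      map_star' := fun y => by rw [map_star]; rfl }
  exact norm_le_maxNorm_of_hilbert.{u, v} hE π x

end MaxNorm

/-! ### Covariant pairs and the full crossed product -/

section CrossedProductHom

variable {A A' : Type u} {Γ : Type v} [NonUnitalRing A] [StarRing A] [Module ℂ A]
  [NonUnitalRing A'] [StarRing A'] [Module ℂ A'] [Group Γ]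

/-- The C⋆-identity `‖π y‖² = ‖π (y y*)‖`. It controls `y = x u` for a unitary `u` that need not
belong to the algebra, so that `π u` has no meaning. -/
theorem HilbertRep.norm_map_eq_of_mul_star_eq (R : HilbertRep A) {x y : A}
    (h : y * star y = x * star x) : ‖R.π y‖ = ‖R.π x‖ := by
  rw [← mul_self_inj (norm_nonneg _) (norm_nonneg _), ← CStarRing.norm_self_mul_star,
    ← CStarRing.norm_self_mul_star, ← map_star, ← map_star, ← map_mul, ← map_mul, h]

theorem maxNorm_eq_of_mul_star_eq {x y : A} (h : y * star y = x * star x) :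
    maxNorm A y = maxNorm A x := by
  simp only [maxNorm, repNorms, fun R : HilbertRep A => R.norm_map_eq_of_mul_star_eq h]

theorem bddAbove_repNorms_zero : BddAbove (repNorms A 0) := by
  refine ⟨0, ?_⟩
  rintro _ ⟨R, rfl⟩
  simp

theorem bddAbove_repNorms_add {x y : A} (hx : BddAbove (repNorms A x))
    (hy : BddAbove (repNorms A y)) : BddAbove (repNorms A (x + y)) := by
  obtain ⟨C, hC⟩ := hx
  obtain ⟨D, hD⟩ := hy
  refine ⟨C + D, ?_⟩
  rintro _ ⟨R, rfl⟩
  simp only [map_add]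
  exact (norm_add_le _ _).trans (add_le_add (hC ⟨R, rfl⟩) (hD ⟨R, rfl⟩))

/-- If `y y* = x x*` for some `x` in the image of a `*`-algebra with finite maximal norm, then the
norms of `y` in all representations are bounded. -/
theorem bddAbove_repNorms_of_mul_star_eq (h : MaxNormFinite A) (j : A →⋆ₙₐ[ℂ] A') {x : A} {y : A'}
    (hy : y * star y = j x * star (j x)) : BddAbove (repNorms A' y) := by
  refine ⟨maxNorm A x, ?_⟩
  rintro _ ⟨R, rfl⟩
  exact (R.norm_map_eq_of_mul_star_eq hy).le.trans
    (norm_rep_le h { H := R.H, π := R.π.comp j } x)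

/-- The extension to the maximal completion of right multiplication by a unitary multiplier. -/
def MaxCStar.mapOfMulStar (h : MaxNormFinite A) (ρ : A →ₗ[ℂ] A) : MaxCStar h →L[ℂ] MaxCStar h :=
  ((of h : A →ₗ[ℂ] MaxCStar h) ∘ₗ ρ).extendOfNorm (of h : A →ₗ[ℂ] MaxCStar h)

/-- Preserving `x x*` makes `ρ` isometric for the maximal norm, so the bound required by
`extendOfNorm` holds with constant `1`. -/
theorem MaxCStar.mapOfMulStar_of (h : MaxNormFinite A) (ρ : A →ₗ[ℂ] A)
    (hρ : ∀ x, ρ x * star (ρ x) = x * star x) (x : A) :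
    mapOfMulStar h ρ (of h x) = of h (ρ x) :=
  LinearMap.extendOfNorm_eq (f := (of h : A →ₗ[ℂ] MaxCStar h) ∘ₗ ρ)
    (e := (of h : A →ₗ[ℂ] MaxCStar h)) (denseRange_of h)
    ⟨1, fun x => by
      rw [one_mul]
      exact ((norm_of h (ρ x)).trans ((maxNorm_eq_of_mul_star_eq (hρ x)).trans
        (norm_of h x).symm)).le⟩ x

open AlgCrossedProduct MaxCStar in
/-- A covariant pair `(j, u)`, consisting of a `*`-homomorphism `j : A → A'` and of unitary
multipliers `u γ` of `A'` that act by right multiplication as `ρ γ`, induces a `*`-homomorphism from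
the full crossed product of the maximal completion of `A` to the maximal completion of `A'`. -/
theorem exists_fullCrossedProduct_hom (h : MaxNormFinite A) (h' : MaxNormFinite A')
    (α : Γ →* (A →⋆ₙₐ[ℂ] A)) (j : A →⋆ₙₐ[ℂ] A') (ρ : Γ → A' →ₗ[ℂ] A')
    (hρ : ∀ γ x, ρ γ x * star (ρ γ x) = x * star x)
    (hmul : ∀ γ γ' a b, ρ γ (j a) * ρ γ' (j b) = ρ (γ * γ') (j (a * α γ b)))
    (hstar : ∀ γ a, star (ρ γ (j a)) = ρ γ⁻¹ (j (α γ⁻¹ (star a)))) :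
    ∃ Φ : FullCrossedProduct (mapAction h α) →⋆ₙₐ[ℂ] MaxCStar h',
      ∀ γ a, Φ (of _ (single γ (of h a))) = of h' (ρ γ (j a)) := by
  let ι : MaxCStar h →⋆ₙₐ[ℂ] MaxCStar h' := map h h' j
  let f : Γ → MaxCStar h → MaxCStar h' := fun γ b => mapOfMulStar h' (ρ γ) (ι b)
  have cont : ∀ {C D : Type u} [NonUnitalCStarAlgebra C] [NonUnitalCStarAlgebra D]
      (φ : C →⋆ₙₐ[ℂ] D), Continuous φ := fun φ =>
    AddMonoidHomClass.continuous_of_bound φ 1 fun x => by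
      rw [one_mul]; exact NonUnitalStarAlgHom.norm_apply_le φ x
  have hf : ∀ γ, Continuous (f γ) := fun γ => (mapOfMulStar h' (ρ γ)).continuous.comp (cont ι)
  have f_of : ∀ γ a, f γ (of h a) = of h' (ρ γ (j a)) := fun γ a => by
    simp only [f, ι, map_of, mapOfMulStar_of h' (ρ γ) (hρ γ)]
  have act_of : ∀ γ a, mapAction h α γ (of h a) = of h (α γ a) := fun γ a => map_of h h (α γ) a
  -- Covariance is assumed on `A` only. Both sides are continuous, so the product and star relations
  -- pass to the completion by density.
  have f_mul : ∀ γ γ' b b', f γ b * f γ' b' = f (γ * γ') (b * mapAction h α γ b') := by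
    intro γ γ' b b'
    have c1 := hf γ
    have c2 := hf γ'
    have c3 := hf (γ * γ')
    have c4 := cont (mapAction h α γ)
    refine (denseRange_of h).induction_on₂
      (p := fun b b' => f γ b * f γ' b' = f (γ * γ') (b * mapAction h α γ b')) ?_ ?_ b b'
    · exact isClosed_eq (by fun_prop) (by fun_prop)
    · intro a a'
      rw [act_of, ← map_mul, f_of, f_of, f_of, ← map_mul, hmul]
  have f_star : ∀ γ b, star (f γ b) = f γ⁻¹ (mapAction h α γ⁻¹ (star b)) := by
    intro γ b
    have c1 := hf γ
    have c2 := hf γ⁻¹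
    have c4 := cont (mapAction h α γ⁻¹)
    refine (denseRange_of h).induction_on
      (p := fun b => star (f γ b) = f γ⁻¹ (mapAction h α γ⁻¹ (star b))) b ?_ ?_
    · exact isClosed_eq (by fun_prop) (by fun_prop)
    · intro a
      rw [f_of, ← map_star (of h'), ← map_star (of h), act_of, f_of, hstar]
  let F : AlgCrossedProduct (mapAction h α) →+ MaxCStar h' := liftAdd fun γ =>
    { toFun := f γ
      map_zero' := by simp only [f, map_zero]
      map_add' := fun x y => by simp only [f, map_add] }
  have F_single : ∀ γ b, F (single γ b) = f γ b := fun γ b => liftAdd_single _ γ b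
  let φ : AlgCrossedProduct (mapAction h α) →⋆ₙₐ[ℂ] MaxCStar h' :=
    { toFun := F
      map_zero' := map_zero F
      map_add' := map_add F
      map_smul' := fun c x => by
        rw [MonoidHom.id_apply]
        induction x using AlgCrossedProduct.induction_on with
        | h0 => simp only [smul_zero, map_zero]
        | hadd a b ha hb => rw [smul_add, map_add, ha, hb, map_add, smul_add]
        | hs γ b => rw [smul_single, F_single, F_single]; simp only [f, map_smul]
      map_mul' := fun x y => by
        induction x using AlgCrossedProduct.induction_on with
        | h0 => simp only [zero_mul, map_zero]
        | hadd a b ha hb => rw [add_mul, map_add, ha, hb, map_add, add_mul]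
        | hs γ b =>
        induction y using AlgCrossedProduct.induction_on with
        | h0 => simp only [mul_zero, map_zero]
        | hadd a b ha hb => rw [mul_add, map_add, ha, hb, map_add, mul_add]
        | hs γ' b' => rw [single_mul_single, F_single, F_single, F_single, f_mul]
      map_star' := fun x => by
        induction x using AlgCrossedProduct.induction_on with
        | h0 => simp only [star_zero, map_zero]
        | hadd a b ha hb => rw [star_add, map_add, ha, hb, map_add, star_add]
        | hs γ b => rw [star_single, F_single, F_single, f_star] }
  refine ⟨lift (maxNormFinite _) φ (norm_le_maxNorm_of_maxCStar.{u, v} (maxNormFinite _) h' φ), fun γ a => ?_⟩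
  rw [lift_of]
  exact (F_single γ (of h a)).trans (f_of γ a)

end CrossedProductHom

/-! ### Multiplication by indicator functions -/

section IndicatorOperators

variable {Z : Type u} [MeasurableSpace Z] (μ : Measure Z)

open Classical in
/-- The projection of `L²(Z, μ)` onto the functions that vanish outside the measurable set `s`. -/
def indOp (s : Set Z) : L2 μ →L[ℂ] L2 μ :=
  if h : MeasurableSet s then
    (ContinuousLinearMap.mul ℂ ℂ).holderL μ ∞ 2 2 ((memLp_top_const (1 : ℂ)).indicator h).toLp
  else 0

variable {μ} {s t : Set Z}

theorem indOp_coe (hs : MeasurableSet s) (ξ : L2 μ) : indOp μ s ξ =ᵐ[μ] s.indicator ξ := by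
  rw [indOp, dif_pos hs]
  have h0 : MemLp (s.indicator fun _ => (1 : ℂ)) ∞ μ := (memLp_top_const (1 : ℂ)).indicator hs
  have h1 := (ContinuousLinearMap.mul ℂ ℂ).coeFn_holder (r := 2) h0.toLp ξ
  filter_upwards [h1, h0.coeFn_toLp] with z hz1 hz2
  refine hz1.trans ?_
  rw [hz2]
  by_cases hz : z ∈ s <;> simp [hz]

theorem indOp_mul_indOp (hs : MeasurableSet s) (ht : MeasurableSet t) :
    indOp μ s * indOp μ t = indOp μ (s ∩ t) := by
  ext1 ξ
  apply Lp.ext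
  filter_upwards [indOp_coe hs (indOp μ t ξ), indOp_coe ht ξ, indOp_coe (hs.inter ht) ξ]
    with z h1 h2 h3
  refine h1.trans ?_
  rw [h3]
  by_cases hzs : z ∈ s <;> by_cases hzt : z ∈ t <;> simp [hzs, hzt, h2]

theorem indOp_comm (hs : MeasurableSet s) (ht : MeasurableSet t) :
    indOp μ s * indOp μ t = indOp μ t * indOp μ s := by
  rw [indOp_mul_indOp hs ht, indOp_mul_indOp ht hs, inter_comm]

theorem indOp_mul_of_subset (hs : MeasurableSet s) (ht : MeasurableSet t) (h : s ⊆ t) :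
    indOp μ s * indOp μ t = indOp μ s := by
  rw [indOp_mul_indOp hs ht, inter_eq_self_of_subset_left h]

theorem indOp_mul_of_subset' (hs : MeasurableSet s) (ht : MeasurableSet t) (h : s ⊆ t) :
    indOp μ t * indOp μ s = indOp μ s := by
  rw [indOp_mul_indOp ht hs, inter_eq_self_of_subset_right h]

@[simp]
theorem indOp_empty : indOp μ (∅ : Set Z) = 0 := by
  ext1 ξ
  apply Lp.ext
  filter_upwards [indOp_coe .empty ξ, Lp.coeFn_zero ℂ 2 μ] with z h1 h2
  refine h1.trans (Eq.trans ?_ h2.symm)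
  simp

@[simp]
theorem indOp_univ : indOp μ (univ : Set Z) = 1 := by
  ext1 ξ
  apply Lp.ext
  filter_upwards [indOp_coe .univ ξ] with z h1
  rw [h1]
  simp

theorem indOp_union (hs : MeasurableSet s) (ht : MeasurableSet t) (h : Disjoint s t) :
    indOp μ (s ∪ t) = indOp μ s + indOp μ t := by
  ext1 ξ
  apply Lp.ext
  filter_upwards [indOp_coe hs ξ, indOp_coe ht ξ, indOp_coe (hs.union ht) ξ,
    Lp.coeFn_add (indOp μ s ξ) (indOp μ t ξ)] with z h1 h2 h3 h4
  rw [h3, indicator_union_of_disjoint h]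
  refine Eq.trans ?_ h4.symm
  simp [h1, h2]

theorem indOp_biUnion {ι : Type*} (F : Finset ι) {s : ι → Set Z} (hs : ∀ i, MeasurableSet (s i))
    (hd : Pairwise fun i j => Disjoint (s i) (s j)) :
    indOp μ (⋃ i ∈ F, s i) = ∑ i ∈ F, indOp μ (s i) := by
  classical
  induction F using Finset.induction_on with
  | empty => simp
  | insert i F hi ih =>
    rw [Finset.set_biUnion_insert, Finset.sum_insert hi, ← ih,
      indOp_union (hs i) (F.measurableSet_biUnion fun j _ => hs j)]
    rw [disjoint_iUnion₂_right]
    exact fun j hj => hd fun h => hi (h ▸ hj)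

@[simp]
theorem star_indOp : star (indOp μ s) = indOp μ s := by
  by_cases hs : MeasurableSet s
  · rw [ContinuousLinearMap.star_eq_adjoint]
    symm
    rw [ContinuousLinearMap.eq_adjoint_iff]
    intro ξ η
    rw [L2.inner_def, L2.inner_def]
    apply integral_congr_ae
    filter_upwards [indOp_coe hs ξ, indOp_coe hs η] with z h1 h2
    rw [h1, h2]
    by_cases hz : z ∈ s <;> simp [hz]
  -- For non-measurable sets `indOp` has the self-adjoint default value `0`, so measurability need
  -- not be assumed.
  · rw [indOp, dif_neg hs, star_zero]

/-- Each hypothesis gives vanishing almost everywhere on one piece; countability lets the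
exceptional null sets be united. -/
theorem eq_zero_of_indOp {ι : Type*} [Countable ι] {s : ι → Set Z} (hs : ∀ i, MeasurableSet (s i))
    (hu : ⋃ i, s i = univ) {v : L2 μ} (h : ∀ i, indOp μ (s i) v = 0) : v = 0 := by
  apply Lp.ext
  have h1 : ∀ i, ∀ᵐ z ∂μ, z ∈ s i → v z = 0 := fun i => by
    have h0 := indOp_coe (hs i) v
    rw [h i] at h0
    filter_upwards [h0, Lp.coeFn_zero ℂ 2 μ] with z hz1 hz2 hz
    rw [hz2, indicator_of_mem hz] at hz1
    exact hz1.symm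
  filter_upwards [ae_all_iff.2 h1, Lp.coeFn_zero ℂ 2 μ] with z hz hz0
  rw [hz0]
  have hzu : z ∈ ⋃ i, s i := hu ▸ mem_univ z
  obtain ⟨i, hi⟩ := mem_iUnion.1 hzu
  exact hz i hi

theorem eq_zero_of_mul_indOp {ι : Type*} [Countable ι] {s : ι → Set Z}
    (hs : ∀ i, MeasurableSet (s i)) (hu : ⋃ i, s i = univ) {S : L2 μ →L[ℂ] L2 μ}
    (h : ∀ i, S * indOp μ (s i) = 0) : S = 0 := by
  rw [← star_eq_zero]
  ext1 ξ
  refine eq_zero_of_indOp hs hu fun i => ?_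
  have h1 := congrArg star (h i)
  rw [star_mul, star_indOp, star_zero] at h1
  exact DFunLike.congr_fun h1 ξ

section Continuous

variable [TopologicalSpace Z] [BorelSpace Z]

theorem mulOp_mul_indOp_comm (f : Z →ᵇ ℂ) (hs : MeasurableSet s) :
    mulOp μ f * indOp μ s = indOp μ s * mulOp μ f := by
  ext1 ξ
  apply Lp.ext
  filter_upwards [indOp_coe hs ξ, indOp_coe hs (mulOp μ f ξ), mulOp_coe μ f ξ,
    mulOp_coe μ f (indOp μ s ξ)] with z h1 h2 h3 h4
  refine h4.trans (Eq.trans ?_ h2.symm)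
  by_cases hz : z ∈ s <;> simp [hz, h1, h3]

theorem mulOp_mul_indOp_of_eqOn_zero (f : Z →ᵇ ℂ) (hs : MeasurableSet s) (hf : ∀ z ∉ s, f z = 0) :
    mulOp μ f * indOp μ s = mulOp μ f := by
  ext1 ξ
  apply Lp.ext
  filter_upwards [indOp_coe hs ξ, mulOp_coe μ f ξ, mulOp_coe μ f (indOp μ s ξ)] with z h1 h3 h4
  refine h4.trans (Eq.trans ?_ h3.symm)
  by_cases hz : z ∈ s <;> simp [hz, h1, hf]

theorem mulOp_mul_indOp_of_eqOn_one (f : Z →ᵇ ℂ) (hs : MeasurableSet s) (hf : ∀ z ∈ s, f z = 1) :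
    mulOp μ f * indOp μ s = indOp μ s := by
  ext1 ξ
  apply Lp.ext
  filter_upwards [indOp_coe hs ξ, mulOp_coe μ f (indOp μ s ξ)] with z h1 h4
  refine h4.trans ?_
  by_cases hz : z ∈ s <;> simp [hz, h1, hf]

end Continuous

end IndicatorOperators

/-- The operator `T` is supported on the relation `r`: its matrix coefficients between measurable
sets that contain no related points vanish. -/
def IsSupportedOn {Z : Type u} [MeasurableSpace Z] {μ : Measure Z} (T : L2 μ →L[ℂ] L2 μ)
    (r : Z → Z → Prop) : Prop :=
  ∀ s t : Set Z, MeasurableSet s → MeasurableSet t → (∀ a ∈ s, ∀ b ∈ t, ¬ r a b) →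
    indOp μ s * T * indOp μ t = 0

/-! ### Supports of operators, tested on measurable sets -/

section Support

variable {Z : Type u} [MeasurableSpace Z] {μ : Measure Z} {T : L2 μ →L[ℂ] L2 μ} {r r' : Z → Z → Prop}

theorem IsSupportedOn.mono (h : IsSupportedOn T r) (hr : ∀ a b, r a b → r' a b) :
    IsSupportedOn T r' :=
  fun s t hs ht hst => h s t hs ht fun a ha b hb hab => hst a ha b hb (hr a b hab)

theorem IsSupportedOn.indOp_mul_mul_indOp (h : IsSupportedOn T r) {s t : Set Z}
    (hs : MeasurableSet s) (ht : MeasurableSet t) :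
    IsSupportedOn (indOp μ s * T * indOp μ t) fun a b => a ∈ s ∧ b ∈ t ∧ r a b := by
  intro s' t' hs' ht' h'
  calc indOp μ s' * (indOp μ s * T * indOp μ t) * indOp μ t'
      = (indOp μ s' * indOp μ s) * T * (indOp μ t * indOp μ t') := by simp only [mul_assoc]
    _ = 0 := by
      rw [indOp_mul_indOp hs' hs, indOp_mul_indOp ht ht']
      exact h _ _ (hs'.inter hs) (ht.inter ht') fun a ha b hb hab =>
        h' a ha.1 b hb.2 ⟨ha.2, hb.1, hab⟩

end Support

/-- A bounded continuous function that is `1` on `s`, with support within distance `1` of `s`. -/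
theorem exists_bcf_one_near {Z : Type*} [MetricSpace Z] (s : Set Z) : ∃ χ : Z →ᵇ ℂ, (∀ z ∈ s, χ z = 1) ∧
    ∀ z ∈ tsupport χ, Metric.infEDist z s ≤ 1 := by
  let θ : Z →ᵇ ℝ≥0 := thickenedIndicator one_pos s
  let χ : Z →ᵇ ℂ := BoundedContinuousFunction.ofNormedAddCommGroup (fun z => ((θ z : ℝ) : ℂ))
    (by fun_prop) 1 (fun z => by
      have h1 : θ z ≤ 1 := thickenedIndicator_le_one one_pos s z
      rw [Complex.norm_real, NNReal.norm_eq]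
      exact_mod_cast h1)
  refine ⟨χ, fun z hz => ?_, ?_⟩
  · change ((θ z : ℝ) : ℂ) = 1
    rw [thickenedIndicator_one one_pos s hz]; simp
  · have hcl : IsClosed {z | Metric.infEDist z s ≤ 1} :=
      isClosed_le Metric.continuous_infEDist continuous_const
    refine closure_minimal (fun z hz => ?_) hcl
    have hz1 : z ∈ Metric.thickening 1 s := by
      by_contra hz'
      refine hz ?_
      change ((θ z : ℝ) : ℂ) = 0
      rw [thickenedIndicator_zero one_pos s hz']; simp
    have : Metric.infEDist z s < ENNReal.ofReal 1 := hz1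
    rw [ENNReal.ofReal_one] at this
    exact this.le

/-! ### Finite propagation and local compactness through indicators -/

section Propagation

variable {Z : Type u} [MetricSpace Z] [MeasurableSpace Z] [BorelSpace Z] {μ : Measure Z}
  {T : L2 μ →L[ℂ] L2 μ}

/-- `M_f` absorbs the indicator of the closed set `tsupport f`, so the condition on measurable sets
applies directly, with no loss in the radius. -/
theorem IsSupportedOn.hasFinitePropagation {R : ℝ}
    (h : IsSupportedOn T fun a b => dist a b ≤ R) : HasFinitePropagation μ T := by
  refine ⟨R.toNNReal, fun f g hfg => ?_⟩
  have hz : ∀ k : C₀(Z, ℂ), ∀ z ∉ tsupport k, k.toBCF z = 0 := fun k z hz =>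
    image_eq_zero_of_notMem_tsupport hz
  have hm : ∀ k : C₀(Z, ℂ), MeasurableSet (tsupport k) := fun k =>
    (isClosed_tsupport k).measurableSet
  have h0 : indOp μ (tsupport f) * T * indOp μ (tsupport g) = 0 :=
    h _ _ (hm f) (hm g) fun a ha b hb hab => by
      have h1 : setEDist (tsupport f) (tsupport g) ≤ edist a b :=
        (iInf₂_le a ha).trans (iInf₂_le b hb)
      refine absurd (hfg.trans_le h1) (not_lt.2 ?_)
      rw [edist_dist]
      exact ENNReal.ofReal_le_ofReal hab
  rw [← mulOp_mul_indOp_of_eqOn_zero f.toBCF (hm f) (hz f),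
    ← mulOp_mul_indOp_of_eqOn_zero g.toBCF (hm g) (hz g), mulOp_mul_indOp_comm g.toBCF (hm g)]
  calc mulOp μ f.toBCF * indOp μ (tsupport f) * T * (indOp μ (tsupport g) * mulOp μ g.toBCF)
      = mulOp μ f.toBCF * (indOp μ (tsupport f) * T * indOp μ (tsupport g)) * mulOp μ g.toBCF := by
        simp only [mul_assoc]
    _ = 0 := by rw [h0]; simp

/-- The indicators of `s` and `t` are absorbed by continuous functions equal to `1` on these sets
and supported within distance `1` of them. Testing on measurable sets is what allows operators to be
cut along cells later. -/
theorem HasFinitePropagation.exists_isSupportedOn [LocallyCompactSpace Z] [SigmaCompactSpace Z]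
    (h : HasFinitePropagation μ T) : ∃ R : ℝ, IsSupportedOn T fun a b => dist a b ≤ R := by
  obtain ⟨R, hR⟩ := h
  -- One unit for each of the two thickenings, and one to keep the inequality `R < setEDist` strict.
  refine ⟨R + 3, fun s t hs ht hst => ?_⟩
  obtain ⟨F, hF1, hF⟩ := exists_bcf_one_near s
  obtain ⟨G, hG1, hG⟩ := exists_bcf_one_near t
  have h0 : mulOp μ F * T * mulOp μ G = 0 := by
    refine finProp_bcf μ hR F G ?_
    have h1 : (R : ℝ≥0∞) + 1 ≤ setEDist (tsupport F) (tsupport G) := by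
      refine le_iInf₂ fun a ha => le_iInf₂ fun b hb => ?_
      have h2 : (R + 1 : ℝ≥0∞) + 2 ≤ edist a b + 2 := by
        have h3 : (R + 3 : ℝ≥0∞) ≤ Metric.infEDist a s + edist a b + Metric.infEDist b t := by
          have key : ∀ x ∈ s, (R + 3 : ℝ≥0∞) ≤ edist a x + (edist a b + Metric.infEDist b t) := by
            intro x hx
            have h4 : (R + 3 : ℝ≥0∞) ≤ Metric.infEDist x t := by
              rw [Metric.le_infEDist]
              intro y hy
              rw [edist_dist, ← ENNReal.ofReal_coe_nnreal,
                show (3 : ℝ≥0∞) = ENNReal.ofReal 3 by simp, ← ENNReal.ofReal_add R.coe_nonneg (by norm_num)]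
              exact ENNReal.ofReal_le_ofReal (not_le.1 (hst x hx y hy)).le
            calc (R + 3 : ℝ≥0∞) ≤ Metric.infEDist x t := h4
              _ ≤ edist x a + Metric.infEDist a t := Metric.infEDist_le_edist_add_infEDist
              _ ≤ edist a x + (edist a b + Metric.infEDist b t) := by
                rw [edist_comm x a]
                gcongr
                exact Metric.infEDist_le_edist_add_infEDist
          -- The distance to the empty set is `∞`; subtraction is used only for nonempty `s`.
          rcases s.eq_empty_or_nonempty with rfl | hne
          · simp [Metric.infEDist_empty]
          · rw [add_assoc]
            rw [← tsub_le_iff_right, Metric.le_infEDist]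
            intro x hx
            rw [tsub_le_iff_right]
            exact key x hx
        calc (R + 1 : ℝ≥0∞) + 2 = R + 3 := by rw [add_assoc]; norm_num
          _ ≤ _ := h3
          _ ≤ 1 + edist a b + 1 := by
            gcongr
            · exact hF a ha
            · exact hG b hb
          _ = edist a b + 2 := by rw [add_comm 1, add_assoc]; norm_num
      exact (ENNReal.add_le_add_iff_right (by finiteness)).1 h2
    exact lt_of_lt_of_le (ENNReal.lt_add_right (by finiteness) one_ne_zero) h1
  rw [← mulOp_mul_indOp_of_eqOn_one F hs hF1, ← mulOp_mul_indOp_of_eqOn_one G ht hG1,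
    mulOp_mul_indOp_comm F hs]
  calc indOp μ s * mulOp μ F * T * (mulOp μ G * indOp μ t)
      = indOp μ s * (mulOp μ F * T * mulOp μ G) * indOp μ t := by simp only [mul_assoc]
    _ = 0 := by rw [h0]; simp

theorem IsLocallyCompactOp.indOp_mul (h : IsLocallyCompactOp μ T) {s : Set Z}
    (hs : MeasurableSet s) : IsLocallyCompactOp μ (indOp μ s * T) := fun f hf => by
  rw [← mul_assoc, mulOp_mul_indOp_comm f.toBCF hs, mul_assoc, mul_assoc]
  exact ⟨(h f hf).1.clm_comp _, (h f hf).2.clm_comp _⟩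

theorem IsLocallyCompactOp.mul_indOp (h : IsLocallyCompactOp μ T) {s : Set Z}
    (hs : MeasurableSet s) : IsLocallyCompactOp μ (T * indOp μ s) := fun f hf => by
  rw [mul_assoc, ← mulOp_mul_indOp_comm f.toBCF hs, ← mul_assoc, ← mul_assoc]
  exact ⟨(h f hf).1.comp_clm _, (h f hf).2.comp_clm _⟩

/-- A compactly supported Urysohn function `f` equal to `1` on `K` gives `T 1_s = (T M_f) 1_s`. -/
theorem IsLocallyCompactOp.isCompactOperator_mul_indOp [LocallyCompactSpace Z]
    (h : IsLocallyCompactOp μ T) {s K : Set Z} (hs : MeasurableSet s) (hK : IsCompact K)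
    (hsK : s ⊆ K) : IsCompactOperator (T * indOp μ s) := by
  obtain ⟨f, hf1, -, hfc, -⟩ := exists_continuous_one_zero_of_isCompact hK isClosed_empty
    (disjoint_empty _)
  let k : C₀(Z, ℂ) :=
    { toFun := fun z => (f z : ℂ)
      continuous_toFun := by fun_prop
      zero_at_infty' := (hfc.comp_left (g := fun r : ℝ => (r : ℂ)) rfl).is_zero_at_infty }
  have hkc : HasCompactSupport k := hfc.comp_left (g := fun r : ℝ => (r : ℂ)) rfl
  have hk1 : ∀ z ∈ s, k.toBCF z = 1 := fun z hz => by
    change ((f z : ℝ) : ℂ) = 1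
    rw [hf1 (hsK hz)]; simp
  rw [← mulOp_mul_indOp_of_eqOn_one k.toBCF hs hk1, ← mul_assoc]
  exact (h k hkc).2.comp_clm _

end Propagation

/-! ### Koopman unitaries, supports and local compactness -/

section KoopmanIndicator

variable {Γ : Type v} [Group Γ] {Y : Type u} [MetricSpace Y] [MeasurableSpace Y] [BorelSpace Y]
  [MulAction Γ Y] {μ : Measure Y} [SigmaFinite μ]

/-- Conjugation by `U γ` carries `1_s` to `1_{γ s}`. The translate is written as a preimage under
`γ⁻¹` because measurability is then immediate. -/
theorem IsNonsingularLipschitzAction.koopman_mul_indOp (h : IsNonsingularLipschitzAction Γ μ) (γ : Γ)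
    {s : Set Y} (hs : MeasurableSet s) :
    (h.koopman γ : L2 μ →L[ℂ] L2 μ) * indOp μ s =
      indOp μ ((fun y => γ⁻¹ • y) ⁻¹' s) * (h.koopman γ : L2 μ →L[ℂ] L2 μ) := by
  have hs' : MeasurableSet ((fun y : Y => γ⁻¹ • y) ⁻¹' s) := (h.continuous γ⁻¹).measurable hs
  ext1 ξ
  apply Lp.ext
  refine (h.koopman_coe γ (indOp μ s ξ)).trans ?_
  refine (h.koopmanFun_congr γ (indOp_coe hs ξ)).trans ?_
  filter_upwards [h.koopman_coe γ ξ, indOp_coe hs' ((h.koopman γ : L2 μ →L[ℂ] L2 μ) ξ)] with y h1 h2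
  refine Eq.trans ?_ h2.symm
  by_cases hy : γ⁻¹ • y ∈ s <;> simp [koopmanFun, hy, h1]

theorem IsSupportedOn.mul_koopman (h : IsNonsingularLipschitzAction Γ μ) (γ : Γ)
    {T : L2 μ →L[ℂ] L2 μ} {r : Y → Y → Prop} (hT : IsSupportedOn T r) :
    IsSupportedOn (T * (h.koopman γ : L2 μ →L[ℂ] L2 μ)) fun a b => r a (γ • b) := by
  intro s t hs ht hst
  have ht' : MeasurableSet ((fun y : Y => γ⁻¹ • y) ⁻¹' t) := (h.continuous γ⁻¹).measurable ht
  rw [mul_assoc, mul_assoc, h.koopman_mul_indOp γ ht, ← mul_assoc, ← mul_assoc,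
    hT s _ hs ht' (fun a ha b hb hab => hst a ha _ hb (by simpa only [smul_inv_smul] using hab)), zero_mul]

/-- `M_f` can be moved across the unitary: `T U M_f = T M_{f ∘ γ⁻¹} U`, and `f ∘ γ⁻¹` still has
compact support. -/
theorem IsLocallyCompactOp.mul_koopman (h : IsNonsingularLipschitzAction Γ μ) (γ : Γ)
    {T : L2 μ →L[ℂ] L2 μ} (hT : IsLocallyCompactOp μ T) :
    IsLocallyCompactOp μ (T * (h.koopman γ : L2 μ →L[ℂ] L2 μ)) := fun f hf => by
  have h1 : h.precomp γ (h.precomp γ⁻¹ f) = f := by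
    ext y
    change f (γ⁻¹ • γ • y) = f y
    rw [inv_smul_smul]
  have h2 := h.mulOp_koopman γ (h.precomp γ⁻¹ f)
  rw [h1] at h2
  rw [mul_assoc, ← h2, ← mul_assoc, ← mul_assoc]
  exact ⟨(hT f hf).1.comp_clm _, (hT _ (h.hasCompactSupport_precomp γ⁻¹ hf)).2.comp_clm _⟩

theorem IsNonsingularLipschitzAction.koopman_inv_mul_koopman (hα : IsNonsingularLipschitzAction Γ μ) (γ : Γ) :
    (hα.koopman γ⁻¹ : L2 μ →L[ℂ] L2 μ) * (hα.koopman γ : L2 μ →L[ℂ] L2 μ) = 1 := by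
  rw [← Submonoid.coe_mul, ← map_mul, inv_mul_cancel, map_one, Submonoid.coe_one]

theorem IsNonsingularLipschitzAction.star_koopman (hα : IsNonsingularLipschitzAction Γ μ) (γ : Γ) :
    star (hα.koopman γ : L2 μ →L[ℂ] L2 μ) = (hα.koopman γ⁻¹ : L2 μ →L[ℂ] L2 μ) := by
  rw [map_inv]
  rfl

end KoopmanIndicator

/-! ### Measurable nets and colourings -/

section Nets

/-- A measurable retraction of `Z` onto a countable `ϱ`-separated subset that moves every point by
less than `ϱ`. -/
theorem exists_measurable_net {Z : Type*} [MetricSpace Z] [SecondCountableTopology Z]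
    [MeasurableSpace Z] [BorelSpace Z] {ϱ : ℝ} (hϱ : 0 < ϱ) :
    ∃ p : Z → Z, (range p).Countable ∧ (∀ x y, p x ≠ p y → ϱ ≤ dist (p x) (p y)) ∧
      (∀ z, dist z (p z) < ϱ) ∧ ∀ s, MeasurableSet (p ⁻¹' s) := by
  classical
  rcases isEmpty_or_nonempty Z with hZ | hZ
  · exact ⟨id, Set.to_countable _, fun x => hZ.elim x, fun x => hZ.elim x,
      fun s => by rw [Set.eq_empty_of_isEmpty (id ⁻¹' s)]; exact .empty⟩
  -- A maximal separated set comes within `ϱ` of every point: any other point could be added to it.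
  obtain ⟨N, hN⟩ := zorn_subset {N : Set Z | N.Pairwise fun x y => ϱ ≤ dist x y} fun C hC hchain =>
    ⟨⋃₀ C, (pairwise_sUnion hchain.directedOn).2 fun s hs => hC hs, fun s hs => subset_sUnion_of_mem hs⟩
  have hsep : N.Pairwise fun x y => ϱ ≤ dist x y := hN.prop
  have hcov : ∀ z, ∃ x ∈ N, dist z x < ϱ := by
    intro z
    by_contra! hz
    have hz' : z ∈ N := by
      refine hN.le_of_ge (y := insert z N) ?_ (subset_insert z N) (mem_insert z N)
      refine hsep.insert fun y hy _ => ⟨hz y hy, ?_⟩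
      rw [dist_comm]
      exact hz y hy
    exact absurd (hz z hz') (by simpa using hϱ)
  have hcount : N.Countable := by
    refine PairwiseDisjoint.countable_of_isOpen (s := fun x => Metric.ball x (ϱ / 2)) ?_
      (fun _ _ => Metric.isOpen_ball) (fun x _ => ⟨x, Metric.mem_ball_self (half_pos hϱ)⟩)
    intro x hx y hy hxy
    exact Metric.ball_disjoint_ball (by linarith [hsep hx hy hxy])
  have hne : N.Nonempty := let ⟨x, hx, _⟩ := hcov (Classical.arbitrary Z); ⟨x, hx⟩
  obtain ⟨e, rfl⟩ := hcount.exists_eq_range hne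
  have hex : ∀ z, ∃ n, dist z (e n) < ϱ := fun z => by
    obtain ⟨_, ⟨n, rfl⟩, hn⟩ := hcov z
    exact ⟨n, hn⟩
  -- Each point goes to the first net point of the enumeration within `ϱ`. The choice factors
  -- through `ℕ`, so preimages of arbitrary sets are measurable.
  refine ⟨fun z => e (Nat.find (hex z)), ?_, ?_, fun z => Nat.find_spec (hex z), fun s => ?_⟩
  · refine hcount.mono ?_
    rintro _ ⟨z, rfl⟩
    exact ⟨_, rfl⟩
  · exact fun x y hxy => hsep ⟨_, rfl⟩ ⟨_, rfl⟩ hxy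
  · have hm : Measurable fun z => Nat.find (hex z) :=
      measurable_find hex fun n => measurableSet_lt (by fun_prop) measurable_const
    exact hm (t := e ⁻¹' s) trivial

/-- A set that is covered by finitely many balls contains at most as many separated points. -/
theorem encard_le_of_cover {Z : Type*} [MetricSpace Z] {ϱ : ℝ} {N : Set Z}
    (hN : ∀ x ∈ N, ∀ y ∈ N, x ≠ y → 2 * ϱ ≤ dist x y) {s : Finset Z}
    (hs : N ⊆ ⋃ w ∈ s, Metric.ball w ϱ) : N.encard ≤ s.card := by
  have h1 : ∀ x ∈ N, ∃ w ∈ s, dist x w < ϱ := fun x hx => by simpa using hs hx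
  choose! f hf hfd using h1
  rw [← Set.encard_coe_eq_coe_finsetCard]
  refine encard_le_encard_of_injOn (f := f) hf fun x hx y hy hxy => ?_
  by_contra hne
  have h2 := hN x hx y hy hne
  have h3 := hfd x hx
  have h4 := hfd y hy
  rw [← hxy] at h4
  linarith [dist_triangle_right x y (f x)]

/-- Greedy colouring of a graph in which every vertex has at most `N` neighbours. -/
theorem exists_coloring_of_encard_le {ι : Type*} {r : ι → ι → Prop} (hr : ∀ i j, r i j → r j i)
    {N : ℕ} (hN : ∀ i, {j | r i j}.encard ≤ N) :
    ∃ c : ι → Fin (N + 1), ∀ i j, i ≠ j → r i j → c i ≠ c j := by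
  classical
  -- Colours are assigned along a well-order, each vertex avoiding those of its smaller neighbours.
  -- These occupy at most `N` of the `N + 1` colours, so the default `0` in `F` is never reached.
  obtain ⟨_, hwf⟩ := exists_wellFoundedLT ι
  let F : ∀ i : ι, (∀ j, j < i → Fin (N + 1)) → Fin (N + 1) := fun i ih =>
    if h : ∃ k, ∀ j (hj : j < i), r i j → ih j hj ≠ k then h.choose else 0
  let c : ι → Fin (N + 1) := (wellFounded_lt (α := ι)).fix F
  have hc : ∀ i, c i = F i fun j _ => c j := fun i => WellFounded.fix_eq _ F i
  have key : ∀ i j, j < i → r i j → c j ≠ c i := by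
    intro i
    have h : ∃ k, ∀ j, j < i → r i j → c j ≠ k := by
      by_contra! hk
      have h1 : (univ : Set (Fin (N + 1))) ⊆ c '' {j | r i j} := fun k _ => by
        obtain ⟨j, -, hj, hjk⟩ := hk k
        exact ⟨j, hj, hjk⟩
      have h2 := (encard_le_encard h1).trans ((encard_image_le _ _).trans (hN i))
      rw [encard_univ, ENat.card_eq_coe_fintype_card, Fintype.card_fin] at h2
      have h3 : N + 1 ≤ N := by exact_mod_cast h2
      omega
    rw [hc i]
    simp only [F]
    rw [dif_pos h]
    exact h.choose_spec
  refine ⟨c, fun i j hij hrij => ?_⟩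
  rcases lt_or_gt_of_ne hij with hlt | hlt
  · exact key j i hlt (hr i j hrij)
  · exact (key i j hlt hrij).symm

/-- Net points are `2 * ϱ` apart, so a ball of radius `ϱ` contains at most one of them, and a cover
by `N` balls bounds the degree of the graph `r` on the net. Only colours of net points matter. -/
theorem exists_coloring_of_net {Z : Type*} [MetricSpace Z] {ϱ : ℝ} {p : Z → Z}
    (hp : ∀ x y, p x ≠ p y → 2 * ϱ ≤ dist (p x) (p y)) {r : Z → Z → Prop}
    (hr : ∀ x y, r x y → r y x) {N : ℕ}
    (hN : ∀ z, ∃ s : Finset Z, s.card ≤ N ∧ {x | r z x} ⊆ ⋃ w ∈ s, Metric.ball w ϱ) :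
    ∃ c : Z → Fin (N + 1), ∀ x y, p x ≠ p y → r (p x) (p y) → c (p x) ≠ c (p y) := by
  obtain ⟨c, hc⟩ := exists_coloring_of_encard_le
    (r := fun x y => (x ∈ range p ∧ y ∈ range p) ∧ r x y)
    (fun x y h => ⟨h.1.symm, hr x y h.2⟩) (N := N) fun z => by
      obtain ⟨s, hsN, hs⟩ := hN z
      refine (encard_le_of_cover ?_ ((fun x hx => hs hx.2 :
        {x | (z ∈ range p ∧ x ∈ range p) ∧ r z x} ⊆ _))).trans (by exact_mod_cast hsN)
      rintro _ ⟨⟨-, x, rfl⟩, -⟩ _ ⟨⟨-, y, rfl⟩, -⟩ hxy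
      exact hp x y hxy
  exact ⟨c, fun x y hxy h => hc _ _ hxy ⟨⟨⟨x, rfl⟩, ⟨y, rfl⟩⟩, h⟩⟩

end Nets

/-- A `*`-homomorphism on a closed `*`-subalgebra of a C⋆-algebra is contractive. -/
theorem NonUnitalStarSubalgebra.norm_map_le {B C : Type*} [NonUnitalCStarAlgebra B]
    [NonUnitalCStarAlgebra C] (D : NonUnitalStarSubalgebra ℂ B) (hD : IsClosed (D : Set B))
    (φ : D →⋆ₙₐ[ℂ] C) (x : D) : ‖φ x‖ ≤ ‖(x : B)‖ :=
  let _ : NonUnitalCStarAlgebra D :=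
    NonUnitalStarSubalgebra.nonUnitalCStarAlgebra D (h_closed := hD)
  NonUnitalStarAlgHom.norm_apply_le φ x

/-- `A` is not assumed closed, so `φ` need not be contractive on it. By the C⋆-identity it suffices
that `φ` is contractive at `x* x`, which lies in the C⋆-algebra `D` even when `x` does not. -/
theorem NonUnitalStarSubalgebra.norm_map_le_of_star_mul_self_mem {B C : Type*}
    [NonUnitalCStarAlgebra B] [NonUnitalCStarAlgebra C] {A D : NonUnitalStarSubalgebra ℂ B}
    (hDA : D ≤ A) (hD : IsClosed (D : Set B)) (φ : A →⋆ₙₐ[ℂ] C) (x : A)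
    (hx : star (x : B) * (x : B) ∈ D) : ‖φ x‖ ≤ ‖(x : B)‖ := by
  have h1 := D.norm_map_le hD (φ.comp (NonUnitalStarSubalgebra.inclusion hDA)) ⟨_, hx⟩
  have h2 : (φ.comp (NonUnitalStarSubalgebra.inclusion hDA)) ⟨_, hx⟩ = star (φ x) * φ x := by
    rw [← map_star, ← map_mul]
    rfl
  rw [h2, CStarRing.norm_star_mul_self, CStarRing.norm_star_mul_self] at h1
  exact (mul_self_le_mul_self_iff (norm_nonneg _) (norm_nonneg _)).2 h1

/-- The maximal norm of a `*`-subalgebra `A` of a C⋆-algebra is finite if every element of `A` is a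
finite sum of elements `q` such that `q* q` lies in a C⋆-algebra contained in `A`. -/
theorem maxNormFinite_of_forall_eq_sum {B : Type u} [NonUnitalCStarAlgebra B]
    {A D : NonUnitalStarSubalgebra ℂ B} (hDA : D ≤ A) (hD : IsClosed (D : Set B))
    (h : ∀ x ∈ A, ∃ (n : ℕ) (q : Fin n → B), (∀ k, q k ∈ A ∧ star (q k) * q k ∈ D) ∧
      ∑ k, q k = x) : MaxNormFinite A := by
  rintro ⟨x, hx⟩
  obtain ⟨n, q, hq, hsum⟩ := h x hx
  refine ⟨∑ k, ‖q k‖, ?_⟩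
  rintro _ ⟨R, rfl⟩
  have h1 : (⟨x, hx⟩ : A) = ∑ k, ⟨q k, (hq k).1⟩ := by
    apply Subtype.ext
    rw [AddSubmonoidClass.coe_finsetSum]
    exact hsum.symm
  change ‖R.π ⟨x, hx⟩‖ ≤ _
  rw [h1, map_sum]
  refine (norm_sum_le _ _).trans (Finset.sum_le_sum fun k _ => ?_)
  exact NonUnitalStarSubalgebra.norm_map_le_of_star_mul_self_mem hDA hD R.π ⟨q k, (hq k).1⟩ (hq k).2

/-! ### The C⋆-algebra of block diagonal operators with compact blocks -/

section BlockDiagonal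

variable {Z : Type u} [MeasurableSpace Z] (μ : Measure Z)

/-- The operators that are block diagonal with respect to the fibres of `p`, with compact blocks. -/
def blockDiagonal (p : Z → Z) : NonUnitalStarSubalgebra ℂ (L2 μ →L[ℂ] L2 μ) where
  carrier := {S | ∀ z, indOp μ (p ⁻¹' {z}) * S = S * indOp μ (p ⁻¹' {z}) ∧
    IsCompactOperator (S * indOp μ (p ⁻¹' {z}))}
  zero_mem' := fun z => ⟨by simp, by simpa using isCompactOperator_zero⟩
  add_mem' {S T} hS hT := fun z => ⟨by rw [mul_add, add_mul, (hS z).1, (hT z).1], by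
    rw [add_mul]
    exact (hS z).2.add (hT z).2⟩
  smul_mem' c S hS := fun z => ⟨by rw [mul_smul_comm, smul_mul_assoc, (hS z).1], by
    rw [smul_mul_assoc]
    exact (hS z).2.smul c⟩
  mul_mem' {S T} hS hT := fun z => ⟨by rw [← mul_assoc, (hS z).1, mul_assoc, (hT z).1, mul_assoc],
    by
      rw [mul_assoc]
      exact (hT z).2.clm_comp S⟩
  star_mem' {S} hS := fun z => by
    have h1 := congrArg star (hS z).1
    rw [star_mul, star_mul, star_indOp] at h1
    refine ⟨h1.symm, ?_⟩
    have h2 := isCompactOperator_star (hS z).2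
    rwa [star_mul, star_indOp, ← h1] at h2

theorem mem_blockDiagonal {p : Z → Z} {S : L2 μ →L[ℂ] L2 μ} :
    S ∈ blockDiagonal μ p ↔ ∀ z, indOp μ (p ⁻¹' {z}) * S = S * indOp μ (p ⁻¹' {z}) ∧
      IsCompactOperator (S * indOp μ (p ⁻¹' {z})) :=
  Iff.rfl

/-- Commuting with a fixed projection is a closed condition, and the compact operators are norm
closed. Closedness is what makes representations contractive here. -/
theorem isClosed_blockDiagonal (p : Z → Z) :
    IsClosed (blockDiagonal μ p : Set (L2 μ →L[ℂ] L2 μ)) := by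
  have h1 : (blockDiagonal μ p : Set (L2 μ →L[ℂ] L2 μ)) =
      ⋂ z, {S | indOp μ (p ⁻¹' {z}) * S = S * indOp μ (p ⁻¹' {z})} ∩
        (fun S : L2 μ →L[ℂ] L2 μ => S * indOp μ (p ⁻¹' {z})) ⁻¹' {S | IsCompactOperator S} := by
    ext S
    simp only [SetLike.mem_coe, mem_blockDiagonal, mem_iInter]
    rfl
  rw [h1]
  refine isClosed_iInter fun z => (isClosed_eq (by fun_prop) (by fun_prop)).inter
    (isClosed_setOfPred_isCompactOperator.preimage (by fun_prop))

end BlockDiagonal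

theorem isCompactOperator_sum {H : Type*} [NormedAddCommGroup H] [NormedSpace ℂ H] {ι : Type*}
    (F : Finset ι) {T : ι → H →L[ℂ] H} (hT : ∀ i ∈ F, IsCompactOperator (T i)) :
    IsCompactOperator (∑ i ∈ F, T i : H →L[ℂ] H) :=
  (compactOperator (RingHom.id ℂ) H H).sum_mem hT

theorem indOp_preimage_eq_sum {Z : Type u} [MeasurableSpace Z] {μ : Measure Z} {p : Z → Z}
    (hm : ∀ s, MeasurableSet (p ⁻¹' s)) (F : Finset Z) :
    indOp μ (p ⁻¹' F) = ∑ z ∈ F, indOp μ (p ⁻¹' {z}) := by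
  rw [← indOp_biUnion F (fun z => hm {z}) fun x y hxy => (disjoint_singleton.2 hxy).preimage p,
    ← preimage_iUnion₂]
  congr 2
  ext x
  simp

theorem sum_mul_indOp_fibres {Z : Type u} [MeasurableSpace Z] {μ : Measure Z}
    {p : Z → Z} (hm : ∀ s, MeasurableSet (p ⁻¹' s)) {κ : Type*} [Fintype κ]
    (c : Z → κ) (T : L2 μ →L[ℂ] L2 μ) : ∑ k, T * indOp μ (p ⁻¹' (c ⁻¹' {k})) = T := by
  rw [← Finset.mul_sum, ← indOp_biUnion Finset.univ (fun k => hm (c ⁻¹' {k})) fun i j hij =>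
    ((disjoint_singleton.2 hij).preimage c).preimage p]
  have : ⋃ k ∈ Finset.univ, p ⁻¹' (c ⁻¹' {k}) = univ := eq_univ_of_forall fun z => by simp
  rw [this, indOp_univ, mul_one]

/-- The net points in question lie in a thickening of `K`, which is compact by properness; finitely
many `ϱ`-balls cover it, each with at most one net point. -/
theorem finite_image_net {Z : Type*} [MetricSpace Z] [ProperSpace Z] {ϱ : ℝ} (hϱ : 0 < ϱ) {p : Z → Z}
    (hp : ∀ x y, p x ≠ p y → 2 * ϱ ≤ dist (p x) (p y)) (hpd : ∀ z, dist z (p z) < 2 * ϱ)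
    {K : Set Z} (hK : IsCompact K) : (p '' K).Finite := by
  have hK' : IsCompact (Metric.cthickening (2 * ϱ) K) := hK.cthickening
  obtain ⟨t, -, ht⟩ := hK'.elim_nhds_subcover (fun x => Metric.ball x ϱ)
    fun x _ => Metric.ball_mem_nhds x hϱ
  have h1 : p '' K ⊆ ⋃ w ∈ t, Metric.ball w ϱ := by
    refine Subset.trans ?_ ht
    rintro _ ⟨x, hx, rfl⟩
    refine Metric.mem_cthickening_of_dist_le _ x _ _ hx ?_
    rw [dist_comm]
    exact (hpd x).le
  refine finite_of_encard_le_coe (encard_le_of_cover ?_ h1)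
  rintro _ ⟨x, -, rfl⟩ _ ⟨y, -, rfl⟩ hxy
  exact hp x y hxy

/-! ### Finiteness of the maximal norm for the original metric -/

section Finiteness

variable {Z : Type u} [MetricSpace Z] [MeasurableSpace Z] [BorelSpace Z] {μ : Measure Z}
  [ProperSpace Z]

/-- Points of one fibre are less than `4 * ϱ` apart, which bounds the propagation. A compact set
meets only finitely many fibres, so compactness of the blocks gives local compactness. -/
theorem blockDiagonal_le_roeStarAlgebra {ϱ : ℝ} (hϱ : 0 < ϱ) {p : Z → Z} (hpc : (range p).Countable)
    (hp : ∀ x y, p x ≠ p y → 2 * ϱ ≤ dist (p x) (p y)) (hpd : ∀ z, dist z (p z) < 2 * ϱ)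
    (hm : ∀ s, MeasurableSet (p ⁻¹' s)) : blockDiagonal μ p ≤ roeStarAlgebra μ := by
  intro S hS
  rw [mem_blockDiagonal] at hS
  refine ⟨IsSupportedOn.hasFinitePropagation (R := 4 * ϱ) fun s t hs ht hst => ?_, fun f hf => ?_⟩
  · have := hpc.to_subtype
    refine eq_zero_of_mul_indOp (s := fun z : range p => p ⁻¹' {z.1}) (fun z => hm _) ?_ fun z => ?_
    · refine eq_univ_of_forall fun x => mem_iUnion.2 ⟨⟨p x, x, rfl⟩, rfl⟩
    · by_cases hbt : t ∩ p ⁻¹' {z.1} = ∅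
      · rw [mul_assoc, indOp_mul_indOp ht (hm _), hbt, indOp_empty, mul_zero]
      · obtain ⟨b, hb, hbz⟩ := nonempty_iff_ne_empty.2 hbt
        have hsz : s ∩ p ⁻¹' {z.1} = ∅ := by
          refine eq_empty_of_forall_notMem fun a ha => hst a ha.1 b hb ?_
          have h1 : p a = z.1 := ha.2
          have h2 : p b = z.1 := hbz
          have h3 := hpd a
          have h4 := hpd b
          rw [h1] at h3
          rw [h2] at h4
          linarith [dist_triangle_right a b z.1]
        rw [mul_assoc, indOp_comm ht (hm _), ← mul_assoc, mul_assoc (indOp μ s), ← (hS z.1).1,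
          ← mul_assoc, indOp_mul_indOp hs (hm _), hsz, indOp_empty, zero_mul, zero_mul]
  · let F := (finite_image_net hϱ hp hpd hf).toFinset
    have hF : mulOp μ f.toBCF * indOp μ (p ⁻¹' F) = mulOp μ f.toBCF :=
      mulOp_mul_indOp_of_eqOn_zero _ (hm _) fun z hz => by
        refine image_eq_zero_of_notMem_tsupport (f := f) fun hz' => hz ?_
        simpa [F] using ⟨z, hz', rfl⟩
    have hF' : indOp μ (p ⁻¹' F) * S = S * indOp μ (p ⁻¹' F) := by
      rw [indOp_preimage_eq_sum hm, Finset.sum_mul, Finset.mul_sum]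
      exact Finset.sum_congr rfl fun z _ => (hS z).1
    have hc : IsCompactOperator (S * indOp μ (p ⁻¹' F)) := by
      rw [indOp_preimage_eq_sum hm, Finset.mul_sum]
      exact isCompactOperator_sum F fun z _ => (hS z).2
    constructor
    · rw [← hF, mul_assoc, hF']
      exact hc.clm_comp (mulOp μ f.toBCF)
    · rw [← hF, mulOp_mul_indOp_comm _ (hm _), ← mul_assoc]
      exact hc.comp_clm (mulOp μ f.toBCF)

/-- The compression of a locally compact operator of propagation at most `R` to the union of all
fibres of one colour is block diagonal, if the fibres of the same colour are far apart. -/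
theorem compression_mem_blockDiagonal {ϱ R : ℝ} {p : Z → Z} (hpd : ∀ z, dist z (p z) < 2 * ϱ)
    (hm : ∀ s, MeasurableSet (p ⁻¹' s)) {κ : Type*} {c : Z → κ}
    (hc : ∀ x y, p x ≠ p y → dist (p x) (p y) ≤ R + 4 * ϱ → c (p x) ≠ c (p y))
    {A : L2 μ →L[ℂ] L2 μ} (hA : IsSupportedOn A fun a b => dist a b ≤ R)
    (hAc : IsLocallyCompactOp μ A) (k : κ) :
    indOp μ (p ⁻¹' (c ⁻¹' {k})) * A * indOp μ (p ⁻¹' (c ⁻¹' {k})) ∈ blockDiagonal μ p := by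
  rw [mem_blockDiagonal]
  intro z
  by_cases hz : c z = k
  · have hsub : p ⁻¹' {z} ⊆ p ⁻¹' (c ⁻¹' {k}) := preimage_mono (by simpa using hz)
    set C := p ⁻¹' (c ⁻¹' {k}) \ p ⁻¹' {z} with hC
    have hCm : MeasurableSet C := (hm _).diff (hm _)
    have hsum : indOp μ (p ⁻¹' (c ⁻¹' {k})) = indOp μ (p ⁻¹' {z}) + indOp μ C := by
      rw [← indOp_union (hm _) hCm disjoint_sdiff_right, union_sdiff_cancel hsub]
    -- The margin `4 * ϱ` in `hc` pays for moving both `a` and `b` to their net points.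
    have hfar : ∀ a ∈ p ⁻¹' {z}, ∀ b ∈ C, ¬ dist a b ≤ R := by
      intro a ha b hb hab
      have ha' : p a = z := ha
      have hb' : c (p b) = k := hb.1
      refine hc a b (fun h => hb.2 (h.symm.trans ha')) ?_ (by rw [ha', hz, hb'])
      have h1 := hpd a
      have h2 := hpd b
      rw [dist_comm] at h1
      linarith [dist_triangle4 (p a) a b (p b)]
    have h1 : indOp μ (p ⁻¹' {z}) * A * indOp μ C = 0 := hA _ _ (hm _) hCm hfar
    have h2 : indOp μ C * A * indOp μ (p ⁻¹' {z}) = 0 :=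
      hA _ _ hCm (hm _) fun b hb a ha hab => hfar a ha b hb (by rwa [dist_comm])
    have e1 : indOp μ (p ⁻¹' {z}) * (indOp μ (p ⁻¹' (c ⁻¹' {k})) * A * indOp μ (p ⁻¹' (c ⁻¹' {k}))) =
        indOp μ (p ⁻¹' {z}) * A * indOp μ (p ⁻¹' {z}) := by
      rw [← mul_assoc, ← mul_assoc, indOp_mul_of_subset (hm _) (hm _) hsub, hsum, mul_add, h1,
        add_zero]
    have e2 : indOp μ (p ⁻¹' (c ⁻¹' {k})) * A * indOp μ (p ⁻¹' (c ⁻¹' {k})) * indOp μ (p ⁻¹' {z}) =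
        indOp μ (p ⁻¹' {z}) * A * indOp μ (p ⁻¹' {z}) := by
      rw [mul_assoc, indOp_mul_of_subset' (hm _) (hm _) hsub, hsum, add_mul, add_mul, h2, add_zero]
    refine ⟨e1.trans e2.symm, ?_⟩
    rw [e2, mul_assoc]
    refine (hAc.isCompactOperator_mul_indOp (hm _) (isCompact_closedBall z (2 * ϱ)) ?_).clm_comp
      (indOp μ (p ⁻¹' {z}))
    intro a ha
    have h3 := hpd a
    rw [show p a = z from ha] at h3
    exact h3.le
  -- A fibre of another colour is annihilated on both sides.
  · have hdisj : p ⁻¹' {z} ∩ p ⁻¹' (c ⁻¹' {k}) = ∅ := by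
      rw [← preimage_inter, singleton_inter_eq_empty.2 (by simpa using hz), preimage_empty]
    have e2 : indOp μ (p ⁻¹' (c ⁻¹' {k})) * A * indOp μ (p ⁻¹' (c ⁻¹' {k})) *
        indOp μ (p ⁻¹' {z}) = 0 := by
      rw [mul_assoc, indOp_mul_indOp (hm _) (hm _), inter_comm, hdisj, indOp_empty, mul_zero]
    rw [e2, ← mul_assoc, ← mul_assoc, indOp_mul_indOp (hm _) (hm _), hdisj, indOp_empty, zero_mul,
      zero_mul]
    exact ⟨rfl, isCompactOperator_zero⟩

/-- Cutting by an indicator, which is only a multiplier, can only shrink the support. -/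
theorem mul_indOp_mem_roeStarAlgebra {T : L2 μ →L[ℂ] L2 μ} (hT : T ∈ roeStarAlgebra μ) {s : Set Z}
    (hs : MeasurableSet s) : T * indOp μ s ∈ roeStarAlgebra μ := by
  obtain ⟨R, hR⟩ := hT.1.exists_isSupportedOn
  refine ⟨IsSupportedOn.hasFinitePropagation (R := R) ?_, hT.2.mul_indOp hs⟩
  have h1 := hR.indOp_mul_mul_indOp .univ hs
  rw [indOp_univ, one_mul] at h1
  exact h1.mono fun a b hab => hab.2.2

/-- The maximal norm is finite on the Roe `*`-algebra of a proper space of bounded geometry: every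
element of it is a finite sum of elements `Q` such that `Q* Q` is block diagonal. -/
theorem maxNormFinite_roeStarAlgebra (hg : BoundedGeometry Z) :
    MaxNormFinite (roeStarAlgebra μ) := by
  obtain ⟨ϱ, hϱ, hN⟩ := hg
  obtain ⟨p, hpc, hp, hpd, hm⟩ := exists_measurable_net (Z := Z) (ϱ := 2 * ϱ) (by positivity)
  have hle := blockDiagonal_le_roeStarAlgebra (μ := μ) hϱ hpc hp hpd hm
  refine maxNormFinite_of_forall_eq_sum hle (isClosed_blockDiagonal μ p) fun T hT => ?_
  have hA : star T * T ∈ roeStarAlgebra μ := mul_mem (star_mem hT) hT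
  -- The colouring is adapted to the propagation of `T* T`, because only `(T P_k)* (T P_k)` has to
  -- be block diagonal.
  obtain ⟨R, hR⟩ := hA.1.exists_isSupportedOn
  -- `max R 0` keeps the radius positive, as `R` may be negative; the `1` puts closed balls inside
  -- open ones.
  obtain ⟨N, hN⟩ := hN (max R 0 + 4 * ϱ + 1) (by positivity)
  obtain ⟨c, hc⟩ := exists_coloring_of_net (r := fun x y => dist x y ≤ R + 4 * ϱ) (N := N) hp
    (fun x y h => by rwa [dist_comm]) fun z => by
      obtain ⟨s, hsN, hs⟩ := hN z
      refine ⟨s, hsN, Subset.trans (fun x hx => ?_) hs⟩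
      have hx' : dist z x ≤ R + 4 * ϱ := hx
      rw [Metric.mem_ball, dist_comm]
      linarith [le_max_left R 0]
  refine ⟨N + 1, fun k => T * indOp μ (p ⁻¹' (c ⁻¹' {k})),
    fun k => ⟨mul_indOp_mem_roeStarAlgebra hT (hm _), ?_⟩, sum_mul_indOp_fibres hm c T⟩
  have h1 := compression_mem_blockDiagonal hpd hm hc hR hA.2 k
  have h2 : star (T * indOp μ (p ⁻¹' (c ⁻¹' {k}))) * (T * indOp μ (p ⁻¹' (c ⁻¹' {k}))) =
      indOp μ (p ⁻¹' (c ⁻¹' {k})) * (star T * T) * indOp μ (p ⁻¹' (c ⁻¹' {k})) := by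
    rw [star_mul, star_indOp]
    simp only [mul_assoc]
  rw [h2]
  exact h1

end Finiteness

/-! ### Surjectivity from generation by products with unitaries -/

section SurjectiveCrossedProduct

open MaxCStar AlgCrossedProduct

/-- Let `A ≤ A'` be `*`-subalgebras of a C⋆-algebra and `U` a unitary representation that normalises
`A`, such that `A'` is generated by the products `s * U γ` with `s ∈ A` as an additive monoid. Then
the maximal completion of `A'` is a quotient of the full crossed product of that of `A`. -/
theorem exists_surjective_fullCrossedProduct_hom {B : Type u} [NonUnitalCStarAlgebra B]
    {Γ : Type v} [Group Γ] {A A' : NonUnitalStarSubalgebra ℂ B} (hA : MaxNormFinite A) (hAA' : A ≤ A')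
    (ρ : Γ → B →ₗ[ℂ] B) (hρ : ∀ γ, ∀ x ∈ A', ρ γ x ∈ A')
    (hiso : ∀ γ x, ρ γ x * star (ρ γ x) = x * star x) (α : Γ →* (A →⋆ₙₐ[ℂ] A))
    (hmul : ∀ γ γ' (a b : A), ρ γ a * ρ γ' b = ρ (γ * γ') (a * α γ b))
    (hstar : ∀ γ (a : A), star (ρ γ (a : B)) = ρ γ⁻¹ (α γ⁻¹ (star a)))
    (hgen : ∀ x ∈ A', x ∈ AddSubmonoid.closure {y | ∃ γ, ∃ s ∈ A, y = ρ γ s}) :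
    ∃ (hA' : MaxNormFinite A') (Φ : FullCrossedProduct (mapAction hA α) →⋆ₙₐ[ℂ] MaxCStar hA'),
      Function.Surjective Φ := by
  let j : A →⋆ₙₐ[ℂ] A' := NonUnitalStarSubalgebra.inclusion hAA'
  let σ : Γ → A' →ₗ[ℂ] A' := fun γ =>
    { toFun := fun x => ⟨ρ γ x, hρ γ x x.2⟩
      map_add' := fun x y => Subtype.ext (map_add (ρ γ) (x : B) (y : B))
      map_smul' := fun c x => Subtype.ext (map_smul (ρ γ) c (x : B)) }
  have hσ : ∀ γ x, σ γ x * star (σ γ x) = x * star x := fun γ x => Subtype.ext (hiso γ x)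
  -- The generation hypothesis as an induction principle. It gives both the finiteness of the
  -- maximal norm of `A'` and the inclusion of the image of `A'` in the range of `Φ`.
  have hgen' : ∀ P : A' → Prop, (∀ γ s, P (σ γ (j s))) → P 0 → (∀ x y, P x → P y → P (x + y)) →
      ∀ x, P x := by
    intro P h1 h2 h3 x
    have key : ∃ y : A', (y : B) = x ∧ P y := by
      refine AddSubmonoid.closure_induction (motive := fun x _ => ∃ y : A', (y : B) = x ∧ P y)
        ?_ ⟨0, rfl, h2⟩ ?_ (hgen x x.2)
      · rintro _ ⟨γ, s, hs, rfl⟩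
        exact ⟨_, rfl, h1 γ ⟨s, hs⟩⟩
      · rintro _ _ - - ⟨y, rfl, hy⟩ ⟨z, rfl, hz⟩
        exact ⟨y + z, rfl, h3 y z hy hz⟩
    obtain ⟨y, hy, hP⟩ := key
    exact Subtype.ext hy ▸ hP
  have hA' : MaxNormFinite A' := hgen' _
    (fun γ s => bddAbove_repNorms_of_mul_star_eq hA j (hσ γ (j s))) bddAbove_repNorms_zero
    fun x y hx hy => bddAbove_repNorms_add hx hy
  obtain ⟨Φ, hΦ⟩ := exists_fullCrossedProduct_hom hA hA' α j σ hσ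
    (fun γ γ' a b => Subtype.ext (hmul γ γ' a b)) (fun γ a => Subtype.ext (hstar γ a))
  refine ⟨hA', Φ, Φ.surjective_of_denseRange ((denseRange_of hA').mono ?_)⟩
  rintro _ ⟨x, rfl⟩
  refine hgen' (fun x => of hA' x ∈ range Φ) (fun γ s => ⟨_, hΦ γ s⟩)
    ⟨0, (map_zero Φ).trans (map_zero (of hA')).symm⟩ ?_ x
  rintro x y ⟨a, ha⟩ ⟨b, hb⟩
  exact ⟨a + b, by rw [map_add, ha, hb, map_add]⟩

end SurjectiveCrossedProduct

/-! ### Warped balls in terms of the original metric -/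

section WarpedGeometry

variable {Γ : Type v} [Group Γ] (ℓ : ProperLength Γ) {Y : Type u} [MetricSpace Y] [MulAction Γ Y]

/-- `y` is reached from `x` at cost at most `r`, by finitely many jumps `y → z` that cost `d(y, z)`
and moves `y → γ y` that cost `ℓ(γ)`. -/
inductive WarpChain : Y → Y → ℝ → Prop
  | refl (x : Y) {r : ℝ} (hr : 0 ≤ r) : WarpChain x x r
  | jump {x y : Y} {r : ℝ} (h : WarpChain x y r) (z : Y) {r' : ℝ} (hr : r + dist y z ≤ r') :
      WarpChain x z r'
  | move {x y : Y} {r : ℝ} (h : WarpChain x y r) (γ : Γ) {r' : ℝ} (hr : r + ℓ γ ≤ r') :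
      WarpChain x (γ • y) r'

variable {ℓ}

namespace WarpChain

theorem nonneg {x y : Y} {r : ℝ} (h : WarpChain ℓ x y r) : 0 ≤ r := by
  induction h with
  | refl hr => exact hr
  | @jump y r h z r' hr ih => linarith [dist_nonneg (x := y) (y := z)]
  | move h γ hr ih => linarith [ℓ.nonneg γ]

theorem mono {x y : Y} {r s : ℝ} (h : WarpChain ℓ x y r) (hrs : r ≤ s) : WarpChain ℓ x y s := by
  cases h with
  | refl hr => exact .refl x (hr.trans hrs)
  | jump h _ hr => exact .jump h _ (hr.trans hrs)
  | move h γ hr => exact .move h γ (hr.trans hrs)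

theorem trans {x y z : Y} {r s : ℝ} (h : WarpChain ℓ x y r) (h' : WarpChain ℓ y z s) :
    WarpChain ℓ x z (r + s) := by
  induction h' with
  | refl hr => exact h.mono (by linarith)
  | jump h' z hr ih => exact .jump ih z (by linarith)
  | move h' γ hr ih => exact .move ih γ (by linarith)

theorem symm {x y : Y} {r : ℝ} (h : WarpChain ℓ x y r) : WarpChain ℓ y x r := by
  induction h with
  | refl hr => exact .refl x hr
  | @jump y r h z r' hr ih =>
    exact ((WarpChain.jump (.refl z le_rfl) y (zero_add (dist z y)).le).trans ih).mono
      (by rw [dist_comm]; linarith)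
  | @move y r h γ r' hr ih =>
    have h1 : WarpChain ℓ (γ • y) (γ⁻¹ • γ • y) (ℓ γ⁻¹) :=
      .move (.refl _ le_rfl) γ⁻¹ (zero_add (ℓ γ⁻¹)).le
    rw [inv_smul_smul, ℓ.symm] at h1
    exact (h1.trans ih).mono (by linarith)

theorem le_of_isWarpAdmissible {m : Y → Y → ℝ} (hm : IsWarpAdmissible ℓ m) {x y : Y} {r : ℝ}
    (h : WarpChain ℓ x y r) : m x y ≤ r := by
  induction h with
  | refl hr => rwa [(hm.isMetric.eq_zero_iff x x).2 rfl]
  | @jump y r h z r' hr ih => linarith [hm.isMetric.triangle x y z, hm.le_dist y z]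
  | @move y r h γ r' hr ih => linarith [hm.isMetric.triangle x y (γ • y), hm.le_length γ y]

/-- Concatenation and reversal of chains give the triangle inequality and symmetry. Distinct points
stay at positive distance because every chain costs at least `warpedDist`, already known to be a
metric. -/
theorem isWarpAdmissible_sInf :
    IsWarpAdmissible ℓ fun x y : Y => sInf {r | WarpChain ℓ x y r} := by
  have hb : ∀ x y : Y, BddBelow {r | WarpChain ℓ x y r} := fun x y => ⟨0, fun r h => h.nonneg⟩
  have hd : ∀ x y : Y, WarpChain ℓ x y (dist x y) := fun x y =>
    .jump (.refl x le_rfl) y (zero_add _).le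
  have hne : ∀ x y : Y, {r | WarpChain ℓ x y r}.Nonempty := fun x y => ⟨_, hd x y⟩
  refine ⟨⟨fun x y => ⟨fun h => ?_, ?_⟩, fun x y => ?_, fun x y z => ?_⟩,
    fun x y => csInf_le (hb x y) (hd x y), fun γ y => csInf_le (hb _ _) ?_⟩
  · have hm := isWarpAdmissible_warpedDist (Y := Y) ℓ
    have h1 : warpedDist ℓ x y ≤ sInf {r | WarpChain ℓ x y r} :=
      le_csInf (hne x y) fun r hr => hr.le_of_isWarpAdmissible hm
    have h2 : 0 ≤ warpedDist ℓ x y := by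
      have := hm.isMetric.triangle x y x
      rw [(hm.isMetric.eq_zero_iff x x).2 rfl, hm.isMetric.symm y x] at this
      linarith
    exact (hm.isMetric.eq_zero_iff x y).1 (le_antisymm (h1.trans h.le) h2)
  · rintro rfl
    exact le_antisymm (csInf_le (hb x x) (.refl x le_rfl)) (le_csInf (hne x x) fun r h => h.nonneg)
  · congr 1
    ext r
    exact ⟨fun h => h.symm, fun h => h.symm⟩
  · rw [← sub_le_iff_le_add]
    refine le_csInf (hne x y) fun r hr => ?_
    rw [sub_le_iff_le_add, ← sub_le_iff_le_add']
    refine le_csInf (hne y z) fun s hs => ?_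
    rw [sub_le_iff_le_add']
    exact csInf_le (hb x z) (hr.trans hs)
  · exact .move (.refl y le_rfl) γ (zero_add _).le

end WarpChain

/-- Maximality of `warpedDist` bounds the infimum of the chain costs from above, so some chain costs
less than `R`. -/
theorem exists_warpChain_of_warpedDist_lt {x y : Y} {R : ℝ} (h : warpedDist ℓ x y < R) :
    WarpChain ℓ x y R := by
  have hlt : sInf {r | WarpChain ℓ x y r} < R :=
    (le_warpedDist ℓ WarpChain.isWarpAdmissible_sInf x y).trans_lt h
  obtain ⟨r, hr, hrR⟩ := exists_lt_of_csInf_lt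
    ⟨_, WarpChain.jump (.refl x le_rfl) y (zero_add _).le⟩ hlt
  exact WarpChain.mono hr hrR.le

/-- A ball for the warped metric is contained in finitely many balls for the original metric, whose
centres are translates of the original centre by finitely many group elements. -/
theorem exists_finset_dist_le_of_warpedDist_le (ℓ : ProperLength Γ)
    (hlip : ∀ γ : Γ, ∃ K : ℝ≥0, LipschitzWith K fun y : Y => γ • y) (R : ℝ) :
    ∃ (F : Finset Γ) (R' : ℝ), 0 < R' ∧ ∀ x y : Y, warpedDist ℓ x y ≤ R →
      ∃ γ ∈ F, dist (γ • x) y ≤ R' := by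
  choose K hK using hlip
  obtain ⟨c, hc, hgap⟩ := ℓ.exists_gap
  -- Chains exist only for strict bounds, hence `R + 1`. Every element used by such a chain, and the
  -- product of them all, has length at most `R + 1`.
  let F : Finset Γ := (ℓ.proper (R + 1)).toFinset
  have hF : ∀ γ, γ ∈ F ↔ ℓ γ ≤ R + 1 := fun γ => by simp [F]
  let L : ℝ := 1 + ∑ γ ∈ F, (K γ : ℝ)
  have hL1 : 1 ≤ L := by
    have : 0 ≤ ∑ γ ∈ F, (K γ : ℝ) := Finset.sum_nonneg fun _ _ => NNReal.coe_nonneg _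
    simp only [L]
    linarith
  have hKL : ∀ γ ∈ F, (K γ : ℝ) ≤ L := fun γ hγ => by
    have := Finset.single_le_sum (f := fun γ => (K γ : ℝ)) (fun _ _ => NNReal.coe_nonneg _) hγ
    simp only [L]
    linarith
  -- All moves are collected in one element `γ` applied to `x`. The number `k` counts the nontrivial
  -- moves: each stretches earlier jumps by at most `L` and costs at least the gap `c`, so `k` is
  -- bounded in terms of `R`.
  have key : ∀ (x y : Y) (r : ℝ), WarpChain ℓ x y r → r ≤ R + 1 →
      ∃ (γ : Γ) (k : ℕ), ℓ γ ≤ r ∧ k * c ≤ r ∧ dist (γ • x) y ≤ L ^ k * r := by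
    intro x y r h
    induction h with
    | refl hr =>
      intro _
      refine ⟨1, 0, ?_, by simpa using hr, by simpa using hr⟩
      rwa [(ℓ.eq_zero_iff 1).2 rfl]
    | @jump y r h z r' hr ih =>
      intro hr'
      have hd := dist_nonneg (x := y) (y := z)
      obtain ⟨γ, k, h1, h2, h3⟩ := ih (by linarith)
      refine ⟨γ, k, by linarith, by linarith, ?_⟩
      have hLk : 1 ≤ L ^ k := one_le_pow₀ hL1
      nlinarith [dist_triangle (γ • x) y z]
    | @move y r h γ' r' hr ih =>
      intro hr'
      have hr0 := h.nonneg
      have hℓ := ℓ.nonneg γ'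
      obtain ⟨γ, k, h1, h2, h3⟩ := ih (by linarith)
      have hLk : 1 ≤ L ^ k := one_le_pow₀ hL1
      by_cases hγ' : γ' = 1
      · subst hγ'
        rw [one_smul]
        exact ⟨γ, k, by linarith, by linarith, h3.trans (by gcongr; linarith)⟩
      · refine ⟨γ' * γ, k + 1, by linarith [ℓ.subadditive γ' γ], ?_, ?_⟩
        · push_cast
          linarith [hgap γ' hγ']
        · have h4 : dist (γ' • γ • x) (γ' • y) ≤ K γ' * dist (γ • x) y := (hK γ').dist_le_mul _ _
          rw [mul_smul, pow_succ]
          calc dist (γ' • γ • x) (γ' • y) ≤ K γ' * dist (γ • x) y := h4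
            _ ≤ L * (L ^ k * r) := by
              gcongr
              exact hKL γ' ((hF γ').2 (by linarith))
            _ = L ^ k * L * r := by ring
            _ ≤ L ^ k * L * r' := by gcongr; linarith
  let n : ℕ := ⌈(R + 1) / c⌉₊
  refine ⟨F, L ^ n * (max R 0 + 1), by positivity, fun x y hxy => ?_⟩
  have hch := exists_warpChain_of_warpedDist_lt (hxy.trans_lt (lt_add_one R))
  obtain ⟨γ, k, h1, h2, h3⟩ := key x y _ hch le_rfl
  refine ⟨γ, (hF γ).2 h1, h3.trans ?_⟩
  have hkn : k ≤ n := by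
    have h4 : (k : ℝ) ≤ n := ((le_div_iff₀ hc).2 h2).trans (Nat.le_ceil _)
    exact_mod_cast h4
  have := hch.nonneg
  gcongr
  exact le_max_left R 0

/-- Since `δ_Γ ≤ d`, the function is `1`-Lipschitz for `d`. This makes warped balls measurable. -/
theorem continuous_warpedDist_left (z : Y) : Continuous fun x : Y => warpedDist ℓ x z := by
  have hm := isWarpAdmissible_warpedDist (Y := Y) ℓ
  refine (LipschitzWith.of_le_add (f := fun x : Y => warpedDist ℓ x z) fun x y => ?_).continuous
  linarith [hm.isMetric.triangle x y z, hm.le_dist x y]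

end WarpedGeometry

/-! ### Decomposition of operators of finite warped propagation -/

section WarpedRoe

variable {Γ : Type v} [Group Γ] (ℓ : ProperLength Γ) {Y : Type u} [MetricSpace Y] [ProperSpace Y]
  [MeasurableSpace Y] [BorelSpace Y] [MulAction Γ Y] (μ : Measure Y)

/-- The Roe `*`-algebra of the warped space, as an algebra of operators on `L²(Y, μ)`. -/
def warpedRoeStarAlgebra : NonUnitalStarSubalgebra ℂ (L2 μ →L[ℂ] L2 μ) :=
  roeStarAlgebra (Warped.measure ℓ μ)

variable {μ} {T : L2 μ →L[ℂ] L2 μ}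

/-- The warped space has the same topology, measure and operators, so local compactness is the same
condition and only the support condition sees `δ_Γ`. -/
theorem mem_warpedRoeStarAlgebra_iff : T ∈ warpedRoeStarAlgebra ℓ μ ↔
    (∃ R : ℝ, IsSupportedOn T fun a b => warpedDist ℓ a b ≤ R) ∧ IsLocallyCompactOp μ T := by
  refine and_congr ⟨fun h => ?_, fun h => ?_⟩ Iff.rfl
  · exact HasFinitePropagation.exists_isSupportedOn (Z := Warped ℓ Y) (μ := Warped.measure ℓ μ) h
  · exact h.elim fun R hR =>
      IsSupportedOn.hasFinitePropagation (Z := Warped ℓ Y) (μ := Warped.measure ℓ μ) hR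

theorem mem_roeStarAlgebra_iff : T ∈ roeStarAlgebra μ ↔
    (∃ R : ℝ, IsSupportedOn T fun a b => dist a b ≤ R) ∧ IsLocallyCompactOp μ T :=
  and_congr ⟨fun h => h.exists_isSupportedOn, fun ⟨_, hR⟩ => hR.hasFinitePropagation⟩ Iff.rfl

theorem roeStarAlgebra_le_warpedRoeStarAlgebra : roeStarAlgebra μ ≤ warpedRoeStarAlgebra ℓ μ := by
  intro T hT
  rw [mem_roeStarAlgebra_iff] at hT
  rw [mem_warpedRoeStarAlgebra_iff]
  exact ⟨hT.1.imp fun R hR => hR.mono fun a b hab =>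
    ((isWarpAdmissible_warpedDist ℓ).le_dist a b).trans hab, hT.2⟩

variable [SigmaFinite μ] (hα : IsNonsingularLipschitzAction Γ μ)

/-- In the warped metric `γ` moves points by at most `ℓ γ`, so the propagation grows by at most that
amount. -/
theorem mul_koopman_mem_warpedRoeStarAlgebra (γ : Γ) (hT : T ∈ warpedRoeStarAlgebra ℓ μ) :
    T * (hα.koopman γ : L2 μ →L[ℂ] L2 μ) ∈ warpedRoeStarAlgebra ℓ μ := by
  rw [mem_warpedRoeStarAlgebra_iff] at hT ⊢
  obtain ⟨⟨R, hR⟩, hc⟩ := hT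
  refine ⟨⟨R + ℓ γ, (hR.mul_koopman hα γ).mono fun a b hab => ?_⟩, hc.mul_koopman hα γ⟩
  have hm := isWarpAdmissible_warpedDist (Y := Y) ℓ
  have h1 := hm.isMetric.triangle a (γ • b) b
  have h2 := hm.le_length γ b
  rw [hm.isMetric.symm] at h2
  linarith

/-- An operator that is supported on pairs `(a, b)` with `a` close to `γ b` is a product of an
operator in the Roe `*`-algebra and the Koopman unitary of `γ`. -/
theorem exists_eq_mul_koopman {γ : Γ} {R : ℝ} (hT : IsSupportedOn T fun a b => dist a (γ • b) ≤ R)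
    (hc : IsLocallyCompactOp μ T) :
    ∃ S ∈ roeStarAlgebra μ, T = S * (hα.koopman γ : L2 μ →L[ℂ] L2 μ) := by
  refine ⟨T * (hα.koopman γ⁻¹ : L2 μ →L[ℂ] L2 μ), ?_, ?_⟩
  · rw [mem_roeStarAlgebra_iff]
    refine ⟨⟨R, (hT.mul_koopman hα γ⁻¹).mono fun a b hab => ?_⟩, hc.mul_koopman hα γ⁻¹⟩
    rwa [smul_inv_smul] at hab
  · rw [mul_assoc, hα.koopman_inv_mul_koopman, mul_one]

/-- Operators of finite propagation for the warped metric are finite sums of products of operators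
in the Roe `*`-algebra of the original metric and Koopman unitaries. -/
theorem mem_closure_mul_koopman_of_mem_warpedRoeStarAlgebra (hgeom : BoundedGeometry Y)
    (hT : T ∈ warpedRoeStarAlgebra ℓ μ) :
    T ∈ AddSubmonoid.closure
      {X | ∃ γ, ∃ S ∈ roeStarAlgebra μ, X = S * (hα.koopman γ : L2 μ →L[ℂ] L2 μ)} := by
  classical
  rw [mem_warpedRoeStarAlgebra_iff] at hT
  obtain ⟨⟨R, hR⟩, hlc⟩ := hT
  obtain ⟨ϱ, hϱ, hN⟩ := hgeom
  have hm := isWarpAdmissible_warpedDist (Y := Y) ℓ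
  obtain ⟨p, hpc, hp, hpd, hpm⟩ := exists_measurable_net (Z := Y) (ϱ := 2 * ϱ) (by positivity)
  have hpδ : ∀ y, warpedDist ℓ y (p y) ≤ 2 * ϱ := fun y => (hm.le_dist _ _).trans (hpd y).le
  -- Bounded geometry passes to warped balls: each is covered by `F'.card` balls for `d`, and each
  -- of these by `N` balls of radius `ϱ`. The radius `2 * R + 4 * ϱ` is twice the bound `R + 2 * ϱ`
  -- from a row point to the net point of its column.
  obtain ⟨F', R₁, hR₁, hF'⟩ :=
    exists_finset_dist_le_of_warpedDist_le ℓ hα.lipschitz (2 * R + 4 * ϱ)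
  obtain ⟨N, hN⟩ := hN (R₁ + 1) (by positivity)
  obtain ⟨c, hc⟩ := exists_coloring_of_net (r := fun x y => warpedDist ℓ x y ≤ 2 * R + 4 * ϱ)
    (N := F'.card * N) hp (fun x y h => by rwa [hm.isMetric.symm]) fun z => by
      choose s hsN hs using hN
      refine ⟨F'.biUnion fun γ => s (γ • z), Finset.card_biUnion_le_card_mul _ _ _ fun γ _ => hsN _,
        fun x hx => ?_⟩
      obtain ⟨γ, hγ, hγx⟩ := hF' z x hx
      have h1 : x ∈ Metric.ball (γ • z) (R₁ + 1) := by
        rw [Metric.mem_ball, dist_comm]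
        linarith
      obtain ⟨w, hw, hxw⟩ := mem_iUnion₂.1 (hs _ h1)
      exact mem_iUnion₂.2 ⟨w, Finset.mem_biUnion.2 ⟨γ, hγ, hw⟩, hxw⟩
  rw [← sum_mul_indOp_fibres hpm c T]
  refine AddSubmonoid.sum_mem _ fun k _ => ?_
  obtain ⟨F, R', -, hF⟩ := exists_finset_dist_le_of_warpedDist_le ℓ hα.lipschitz (R + 2 * ϱ)
  set B : Set Y := p ⁻¹' (c ⁻¹' {k}) with hB
  -- Rows that are `δ_Γ`-close to some net point `z` of colour `k` and `d`-close to `γ • z`. The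
  -- union is countable, so the set is measurable.
  let V : Γ → Set Y := fun γ => ⋃ z ∈ range p ∩ c ⁻¹' {k},
    {x | warpedDist ℓ x z ≤ R + 2 * ϱ} ∩ {x | dist (γ • z) x ≤ R'}
  have hV : ∀ γ, MeasurableSet (V γ) := fun γ =>
    .biUnion (hpc.mono inter_subset_left) fun z _ =>
      ((isClosed_le (continuous_warpedDist_left z) continuous_const).inter
        (isClosed_le (by fun_prop) continuous_const)).measurableSet
  have hcut : ∀ W : Set Y, MeasurableSet W → IsSupportedOn (indOp μ W * T * indOp μ B)
      fun a b => a ∈ W ∧ b ∈ B ∧ warpedDist ℓ a b ≤ R :=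
    fun W hW => hR.indOp_mul_mul_indOp hW (hpm _)
  have hpiece : ∀ (γ : Γ) (W : Set Y), MeasurableSet W → W ⊆ V γ →
      indOp μ W * T * indOp μ B ∈ AddSubmonoid.closure
        {X | ∃ γ, ∃ S ∈ roeStarAlgebra μ, X = S * (hα.koopman γ : L2 μ →L[ℂ] L2 μ)} := by
    intro γ W hW hWV
    obtain ⟨K, hK⟩ := hα.lipschitz γ
    -- The second summand bounds the distance from `γ • p b` to `γ • b`, with `K` the Lipschitz
    -- constant of `γ`.
    refine AddSubmonoid.subset_closure ⟨γ, exists_eq_mul_koopman hα (R := R' + K * (2 * ϱ))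
      ((hcut W hW).mono ?_) ((hlc.indOp_mul hW).mul_indOp (hpm _))⟩
    rintro a b ⟨ha, hb, hab⟩
    obtain ⟨_, ⟨⟨x, rfl⟩, hxk⟩, ha1, ha2⟩ := mem_iUnion₂.1 (hWV ha)
    have ha1 : warpedDist ℓ a (p x) ≤ R + 2 * ϱ := ha1
    have ha2 : dist (γ • p x) a ≤ R' := ha2
    -- Both net points have colour `k` and lie within `R + 2 * ϱ` of `a`, so the colouring forces
    -- them to agree: the row determines the cell of the column.
    have hxb : p x = p b := by
      by_contra hne
      refine hc x b hne ?_ (Eq.trans hxk (Eq.symm hb))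
      have h1 := hm.isMetric.triangle (p x) a (p b)
      have h2 := hm.isMetric.triangle a b (p b)
      rw [hm.isMetric.symm (p x) a] at h1
      linarith [hpδ b]
    have h3 : dist (γ • p b) (γ • b) ≤ K * dist (p b) b := hK.dist_le_mul _ _
    have h4 : (K : ℝ) * dist (p b) b ≤ K * (2 * ϱ) := by
      gcongr
      rw [dist_comm]
      exact (hpd b).le
    rw [hxb, dist_comm] at ha2
    linarith [dist_triangle a (γ • p b) (γ • b)]
  -- The sets `V γ` may overlap. Removing them from `W` one at a time makes the row pieces disjoint,
  -- and nothing of the support is left over once `G` is exhausted.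
  have hind : ∀ (G : Finset Γ) (W : Set Y), MeasurableSet W →
      (∀ a ∈ W, ∀ b ∈ B, warpedDist ℓ a b ≤ R → ∃ γ ∈ G, a ∈ V γ) →
      indOp μ W * T * indOp μ B ∈ AddSubmonoid.closure
        {X | ∃ γ, ∃ S ∈ roeStarAlgebra μ, X = S * (hα.koopman γ : L2 μ →L[ℂ] L2 μ)} := by
    intro G
    induction G using Finset.induction_on with
    | empty =>
      intro W hW hWV
      rw [hR W B hW (hpm _) fun a ha b hb hab => by simpa using hWV a ha b hb hab]
      exact zero_mem _
    | insert γ G hγ ih =>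
      intro W hW hWV
      have h1 : indOp μ W = indOp μ (W ∩ V γ) + indOp μ (W \ V γ) := by
        rw [← indOp_union (hW.inter (hV γ)) (hW.diff (hV γ)) disjoint_inf_sdiff, inter_union_sdiff]
      rw [h1, add_mul, add_mul]
      refine add_mem (hpiece γ _ (hW.inter (hV γ)) inter_subset_right)
        (ih _ (hW.diff (hV γ)) fun a ha b hb hab => ?_)
      obtain ⟨γ', hγ', haV⟩ := hWV a ha.1 b hb hab
      rcases Finset.mem_insert.1 hγ' with rfl | hγ'
      · exact absurd haV ha.2
      · exact ⟨γ', hγ', haV⟩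
  have hfin := hind F univ .univ fun a _ b hb hab => by
    have h1 : warpedDist ℓ (p b) a ≤ R + 2 * ϱ := by
      rw [hm.isMetric.symm]
      linarith [hm.isMetric.triangle a b (p b), hpδ b]
    obtain ⟨γ, hγ, hγa⟩ := hF (p b) a h1
    refine ⟨γ, hγ, mem_iUnion₂.2 ⟨p b, ⟨⟨b, rfl⟩, hb⟩, ?_, hγa⟩⟩
    change warpedDist ℓ a (p b) ≤ _
    rwa [hm.isMetric.symm]
  rwa [indOp_univ, one_mul] at hfin

end WarpedRoe

end

theorem mainTheorem7 {Γ : Type v} [Group Γ] [Countable Γ] {Y : Type u} [MetricSpace Y]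
    [ProperSpace Y] [MeasurableSpace Y] [BorelSpace Y] [MulAction Γ Y]
    (μ : Measure Y) [SigmaFinite μ]
    (hα : IsNonsingularLipschitzAction Γ μ) (hample : IsAmpleL2 μ)
    (hgeom : BoundedGeometry Y) (ℓ : ProperLength Γ) :
    ∃ (hd : MaxNormFinite (roeStarAlgebra μ))
      (hδ : MaxNormFinite (roeStarAlgebra (Warped.measure ℓ μ))),
      ∃ Φ : FullCrossedProduct (hα.maxRoeAction hd) →⋆ₙₐ[ℂ]
          MaxRoeAlgebra (Warped.measure ℓ μ) hδ,
        Function.Surjective Φ := by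
  have hd : MaxNormFinite (roeStarAlgebra μ) := maxNormFinite_roeStarAlgebra hgeom
  -- This gives the covariance relations `a U_γ b U_γ' = a (U_γ b U_γ*) U_{γγ'}` and `(a U_γ)* =
  -- (U_{γ⁻¹} a* U_{γ⁻¹}*) U_{γ⁻¹}` required below.
  have hcs : ∀ γ (X : L2 μ →L[ℂ] L2 μ), X * star (hα.koopman γ : L2 μ →L[ℂ] L2 μ) *
      (hα.koopman γ : L2 μ →L[ℂ] L2 μ) = X := fun γ X => by
    rw [mul_assoc, Unitary.coe_star_mul_self, mul_one]
  have main := exists_surjective_fullCrossedProduct_hom hd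
    (roeStarAlgebra_le_warpedRoeStarAlgebra ℓ)
    (fun γ => LinearMap.mulRight ℂ (hα.koopman γ : L2 μ →L[ℂ] L2 μ))
    (fun γ x hx => mul_koopman_mem_warpedRoeStarAlgebra ℓ hα γ hx)
    (fun γ x => by
      simp only [LinearMap.mulRight_apply]
      rw [star_mul, ← mul_assoc, mul_assoc x,
        Unitary.mul_star_self_of_mem (hα.koopman γ).2, mul_one])
    hα.roeAction
    (fun γ γ' a b => by
      have h1 : ((hα.roeAction γ b : roeStarAlgebra μ) : L2 μ →L[ℂ] L2 μ) =
        (hα.koopman γ : L2 μ →L[ℂ] L2 μ) * b * star (hα.koopman γ : L2 μ →L[ℂ] L2 μ) := rfl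
      simp only [LinearMap.mulRight_apply]
      rw [h1, map_mul, Submonoid.coe_mul]
      simp only [← mul_assoc]
      rw [hcs])
    (fun γ a => by
      have h1 : ((hα.roeAction γ⁻¹ (star a) : roeStarAlgebra μ) : L2 μ →L[ℂ] L2 μ) =
        (hα.koopman γ⁻¹ : L2 μ →L[ℂ] L2 μ) * star (a : L2 μ →L[ℂ] L2 μ) *
          star (hα.koopman γ⁻¹ : L2 μ →L[ℂ] L2 μ) := rfl
      simp only [LinearMap.mulRight_apply]
      rw [h1, hcs, star_mul, hα.star_koopman])
    (fun T hT => mem_closure_mul_koopman_of_mem_warpedRoeStarAlgebra ℓ hα hgeom hT)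
  obtain ⟨hδ, Φ, hΦ⟩ := main
  exact ⟨hd, hδ, Φ, hΦ⟩
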